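/- Let $I=(-1,1)$ and let $\mu\in\mathbb{C}$ be arbitrary. Let $L^2_d(I)$ be the space of measurable $f\colon I\to\mathbb{C}$ with $\int_{-1}^1 |f(t)|^2\,\frac{dt}{\sqrt{1-t^2}}<\infty$ and $L^2_m(I)$ the space of measurable $f\colon I\to\mathbb{C}$ with $\int_{-1}^1 |f(t)|^2\sqrt{1-t^2}\,dt<\infty$. The symbol $\mathrm{p.v.}\!\int_{-1}^1$ denotes the Cauchy principal value at the singularity $x\in I$ of the integrand, that is, the limit as $\varepsilon\to0^+$ of the integrals over $\{y\in I: |y-x|>\varepsilon\}$. The cosh-weighted finite Hilbert transform of $f$ is $$F_\mu(s)=H_\mu f(s)=\frac1\pi\,\mathrm{p.v.}\!\int_{-1}^1\frac{\cosh[\mu(s-t)]}{s-t}\,f(t)\,dt ,\qquad s\in I.$$ (i) If $f\in L^2_d(I)$, then the principal value defining $F_\mu(s)$ exists for almost every $s\in I$, and for almost every $t\in I$ the two principal-value integrals below exist and $$f(t)=\cosh(i\mu\sqrt{1-t^2})\sqrt{1-t^2}\left[\frac1\pi\,\mathrm{p.v.}\!\int_{-1}^1\frac{F_\mu(s)}{s-t}\,\frac{\cosh(i\mu\sqrt{1-s^2})}{\sqrt{1-s^2}}\,ds\right]-\sinh(i\mu\sqrt{1-t^2})\left[\frac1\pi\,\mathrm{p.v.}\!\int_{-1}^1\frac{F_\mu(s)}{s-t}\,\sinh(i\mu\sqrt{1-s^2})\,ds\right].$$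 (ii) If $f\in L^2_m(I)$, then the principal value defining $F_\mu(s)$ exists for almost every $s\in I$, the function $u\mapsto\cosh(\mu u)f(u)$ is integrable on $I$, and for almost every $t\in I$ the two principal-value integrals below exist and $$f(t)=\frac{\cosh(i\mu\sqrt{1-t^2})}{\sqrt{1-t^2}}\left[\frac1\pi\,\mathrm{p.v.}\!\int_{-1}^1\frac{F_\mu(s)}{s-t}\cosh(i\mu\sqrt{1-s^2})\sqrt{1-s^2}\,ds+\frac1\pi\int_{-1}^1\cosh(\mu u)f(u)\,du\right]-\sinh(i\mu\sqrt{1-t^2})\left[\frac1\pi\,\mathrm{p.v.}\!\int_{-1}^1\frac{F_\mu(s)}{s-t}\,\sinh(i\mu\sqrt{1-s^2})\,ds\right].$$ -/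

import Mathlib

open MeasureTheory Set Filter Topology

noncomputable section

namespace CoshFHT

/-- The open interval `(-1, 1)`. -/
def I : Set ℝ := Ioo (-1) 1

/-- The weight `√(1 - t²)`. -/
def w (t : ℝ) : ℝ := Real.sqrt (1 - t ^ 2)

/-- Membership in the space `L²_m(I)`: square integrability with respect to `√(1 - t²) dt`. -/
def MemL2m (f : ℝ → ℂ) : Prop :=
  AEStronglyMeasurable f (volume.restrict I) ∧
    IntegrableOn (fun t => ‖f t‖ ^ 2 * w t) I

/-- Membership in the space `L²_d(I)`: square integrability with respect to `dt / √(1 - t²)`. -/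
def MemL2d (f : ℝ → ℂ) : Prop :=
  AEStronglyMeasurable f (volume.restrict I) ∧
    IntegrableOn (fun t => ‖f t‖ ^ 2 * (1 / w t)) I

/-- The interval `(-1, 1)` with a symmetric neighbourhood of radius `ε` of `x` removed. -/
def truncated (x ε : ℝ) : Set ℝ := {y ∈ I | ε < |y - x|}

/-- The integral of `g` over `(-1, 1)` exists in the sense of the Cauchy principal value at the
singularity `x`, and its value is `L`: `g` is integrable away from `x`, and the integrals
over `(-1, 1) \ [x - ε, x + ε]` converge to `L` as `ε → 0+`. -/
def HasPV (g : ℝ → ℂ) (x : ℝ) (L : ℂ) : Prop :=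
  (∀ ε > 0, IntegrableOn g (truncated x ε)) ∧
    Tendsto (fun ε : ℝ => ∫ y in truncated x ε, g y) (𝓝[>] 0) (𝓝 L)

/-- The principal-value integral of `g` over `(-1, 1)` with singularity at `x` exists. -/
def PVExists (g : ℝ → ℂ) (x : ℝ) : Prop := ∃ L, HasPV g x L

/-- The value of the principal-value integral (meaningful when `PVExists g x`). -/
def pv (g : ℝ → ℂ) (x : ℝ) : ℂ :=
  limUnder (𝓝[>] (0 : ℝ)) (fun ε : ℝ => ∫ y in truncated x ε, g y)

theorem HasPV.pv_eq {g : ℝ → ℂ} {x : ℝ} {L : ℂ} (h : HasPV g x L) : pv g x = L :=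
  h.2.limUnder_eq

/-- The integrand `t ↦ cosh(μ (s - t)) / (s - t) * f t` of the transform at the point `s`. -/
def coshKernel (μ : ℂ) (f : ℝ → ℂ) (s t : ℝ) : ℂ :=
  Complex.cosh (μ * ((s : ℂ) - t)) / ((s : ℂ) - t) * f t

/-- The cosh-weighted finite Hilbert transform `F_μ = H_μ f`. -/
def coshFHT (μ : ℂ) (f : ℝ → ℂ) (s : ℝ) : ℂ :=
  (1 / (Real.pi : ℂ)) * pv (coshKernel μ f s) s

/-- `cosh(i μ √(1 - t²))`. -/
def C (μ : ℂ) (t : ℝ) : ℂ := Complex.cosh (Complex.I * μ * (w t : ℂ))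

/-- `sinh(i μ √(1 - t²))`. -/
def S (μ : ℂ) (t : ℝ) : ℂ := Complex.sinh (Complex.I * μ * (w t : ℂ))

/-- The integrand `s ↦ F s / (s - t) * k s`. -/
def invKernel (F k : ℝ → ℂ) (t s : ℝ) : ℂ := F s / ((s : ℂ) - t) * k s

end CoshFHT

end

/-! Substitute `t = cos φ` and work with boundary values of functions analytic in the unit disc. An
L² function of φ on (0, π) can be written as `a φ ± a (-φ)` with `a` having only nonnegative
frequencies (`exists_even_lift`, `exists_odd_lift`). In this form the finite Hilbert transform just
changes the sign between the two terms, up to a factor `i` and a power of `sin`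
(`IsEvenLift.ae_hasPV`, `IsOddLift.ae_hasPV`); the odd form also requires `a` to have mean zero.

The addition formula for cosh turns `coshFHT` into a combination of the plain transforms of `e^{-μt}
f` and `e^{μt} f`, with lifts `a₁` and `a₂`. Put `P = outer μ φ`, `Q = outer μ (-φ)`. Then `e^{μ cos
φ} = PQ`, while `C + S = P/Q` and `C - S = Q/P`. Write `F = coshFHT μ f`. The functions `F C` and `F
S`, with the weights of the theorem, lift to `(i/2)(P² a₁ ± P⁻² a₂)`: the cross terms cancel because
`a₁` and `a₂` come from the same `f`. Since `P^{±2} = exp(±μ e^{iφ})` is bounded and analytic, these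
lifts are again of Hardy type and the transform applies a second time. Combining the two results
with `C` and `S` gives, in case (i), `½[PQ (a₁ φ - a₁ (-φ)) + (PQ)⁻¹ (a₂ φ - a₂ (-φ))] = f`. In case
(ii) even and odd are exchanged, and the mean that must be removed from the first lift is the extra
integral of `cosh(μu) f(u)`.

After multiplication by `P^{±2}` the lifts are treated only as integrable functions, so existence of
the principal values is proved in L¹. At a Lebesgue point the truncated integral is compared with a
conjugate Poisson integral along the curve `cos(θ + iη)`. For Hardy functions that integral reduces
to Poisson integrals on the disc, which converge almost everywhere. -/

noncomputable section

namespace CoshFHT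

/-! ### The Hardy class on the circle and its analytic multipliers. -/

/-- Lebesgue measure on `(-π, π)`. -/
def circ : Measure ℝ := volume.restrict (Ioo (-Real.pi) Real.pi)

instance : IsFiniteMeasure circ := by
  unfold circ; infer_instance

/-- Integrable functions on `(-π, π)` whose Fourier coefficients of negative index vanish. -/
structure HardyOne (a : ℝ → ℂ) : Prop where
  integrable : Integrable a circ
  coeff : ∀ n : ℕ, 0 < n → ∫ φ, a φ * Complex.exp (n * (φ * Complex.I)) ∂circ = 0

theorem norm_exp_nat_mul_I (n : ℕ) (φ : ℝ) :
    ‖Complex.exp (n * (φ * Complex.I))‖ = 1 := by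
  rw [Complex.exp_nat_mul, norm_pow, Complex.norm_exp_ofReal_mul_I, one_pow]

theorem integrable_mul_exp_nat {a : ℝ → ℂ} (ha : Integrable a circ) (n : ℕ) :
    Integrable (fun φ : ℝ => a φ * Complex.exp (n * (φ * Complex.I))) circ := by
  refine ha.mul_bdd (c := 1) (by fun_prop) (ae_of_all _ fun φ => ?_)
  rw [norm_exp_nat_mul_I]

/-- Integrate termwise: only the term `k = 0` survives. Pairing with an analytic function thus sees
only its value at the origin of the disc. -/
theorem HardyOne.integral_mul_tsum {a : ℝ → ℂ} (ha : HardyOne a) {c : ℕ → ℂ}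
    (hc : Summable fun k => ‖c k‖) :
    ∫ φ, a φ * ∑' k : ℕ, c k * Complex.exp (k * (φ * Complex.I)) ∂circ = c 0 * ∫ φ, a φ ∂circ := by
  have hint : ∀ k : ℕ, Integrable
      (fun φ : ℝ => c k * (a φ * Complex.exp (k * (φ * Complex.I)))) circ :=
    fun k => (integrable_mul_exp_nat ha.integrable k).const_mul _
  have hsum : Summable fun k : ℕ =>
      ∫ φ : ℝ, ‖c k * (a φ * Complex.exp (k * (φ * Complex.I)))‖ ∂circ := by
    simp only [norm_mul, norm_exp_nat_mul_I, mul_one, integral_const_mul]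
    exact hc.mul_right _
  have h := integral_tsum_of_summable_integral_norm hint hsum
  have hL : ∀ φ : ℝ, a φ * ∑' k : ℕ, c k * Complex.exp (k * (φ * Complex.I)) =
      ∑' k : ℕ, c k * (a φ * Complex.exp (k * (φ * Complex.I))) := by
    intro φ
    rw [← tsum_mul_left]
    exact tsum_congr fun k => by ring
  simp only [hL]
  rw [← h, tsum_eq_single 0]
  · simp [integral_const_mul]
  · intro k hk
    rw [integral_const_mul, ha.coeff k (Nat.pos_of_ne_zero hk), mul_zero]

theorem HardyOne.mul_exp_nat {a : ℝ → ℂ} (ha : HardyOne a) (n : ℕ) :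
    HardyOne (fun φ : ℝ => a φ * Complex.exp (n * (φ * Complex.I))) := by
  refine ⟨integrable_mul_exp_nat ha.integrable n, fun m hm => ?_⟩
  rw [← ha.coeff (n + m) (by omega)]
  refine integral_congr_ae (ae_of_all _ fun φ => ?_)
  simp only
  rw [mul_assoc, ← Complex.exp_add]
  push_cast
  ring_nf

theorem HardyOne.integral_mul_inv_one_sub {a : ℝ → ℂ} (ha : HardyOne a) {v : ℂ} (hv : ‖v‖ < 1) :
    ∫ φ, a φ * (1 - v * Complex.exp (φ * Complex.I))⁻¹ ∂circ = ∫ φ, a φ ∂circ := by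
  have hs : Summable fun k : ℕ => ‖v ^ k‖ := by
    simp only [norm_pow]
    exact summable_geometric_of_lt_one (norm_nonneg _) hv
  have h := ha.integral_mul_tsum hs
  rw [pow_zero, one_mul] at h
  rw [← h]
  refine integral_congr_ae (ae_of_all _ fun φ => ?_)
  simp only
  congr 1
  rw [← tsum_geometric_of_norm_lt_one]
  · exact tsum_congr fun k => by rw [Complex.exp_nat_mul, mul_pow]
  · rwa [norm_mul, Complex.norm_exp_ofReal_mul_I, mul_one]

theorem exp_mul_exp_eq_tsum (c : ℂ) (φ : ℝ) :
    Complex.exp (c * Complex.exp (φ * Complex.I)) =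
      ∑' k : ℕ, (c ^ k / (k.factorial : ℂ)) * Complex.exp (k * (φ * Complex.I)) := by
  have h : ∀ z : ℂ, Complex.exp z = ∑' k : ℕ, z ^ k / (k.factorial : ℂ) := fun z => by
    rw [Complex.exp_eq_exp_ℂ, NormedSpace.exp_eq_tsum_div]
  rw [h]
  refine tsum_congr fun k => ?_
  rw [Complex.exp_nat_mul, mul_pow]
  ring

theorem HardyOne.integral_mul_exp_mul_exp {a : ℝ → ℂ} (ha : HardyOne a) (c : ℂ) :
    ∫ φ : ℝ, a φ * Complex.exp (c * Complex.exp (φ * Complex.I)) ∂circ = ∫ φ, a φ ∂circ := by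
  have hs : Summable fun k : ℕ => ‖c ^ k / (k.factorial : ℂ)‖ := by
    simpa using Real.summable_pow_div_factorial ‖c‖
  have := ha.integral_mul_tsum hs
  simpa [← exp_mul_exp_eq_tsum] using this

theorem norm_exp_mul_exp_le (c : ℂ) (φ : ℝ) :
    ‖Complex.exp (c * Complex.exp (φ * Complex.I))‖ ≤ Real.exp ‖c‖ := by
  refine (Complex.norm_exp_le_exp_norm _).trans ?_
  rw [norm_mul, Complex.norm_exp_ofReal_mul_I, mul_one]

/-- Each coefficient of the product is the mean of `a e^{inφ}` times the exponential. The
exponential equals 1 at the centre of the disc, so it leaves that mean unchanged, namely zero. -/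
theorem HardyOne.mul_exp_mul_exp {a : ℝ → ℂ} (ha : HardyOne a) (c : ℂ) :
    HardyOne (fun φ : ℝ => a φ * Complex.exp (c * Complex.exp (φ * Complex.I))) := by
  refine ⟨?_, fun n hn => ?_⟩
  · exact ha.integrable.mul_bdd (c := Real.exp ‖c‖) (by fun_prop) (ae_of_all _ fun φ => norm_exp_mul_exp_le c φ)
  · have := (ha.mul_exp_nat n).integral_mul_exp_mul_exp c
    rw [ha.coeff n hn] at this
    rw [← this]
    exact integral_congr_ae (ae_of_all _ fun φ => by ring)

theorem HardyOne.add {a b : ℝ → ℂ} (ha : HardyOne a) (hb : HardyOne b) :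
    HardyOne (fun φ => a φ + b φ) := by
  refine ⟨ha.integrable.add hb.integrable, fun n hn => ?_⟩
  simp only [add_mul]
  rw [integral_add (integrable_mul_exp_nat ha.integrable n)
    (integrable_mul_exp_nat hb.integrable n), ha.coeff n hn, hb.coeff n hn, add_zero]

theorem HardyOne.const_mul {a : ℝ → ℂ} (ha : HardyOne a) (c : ℂ) :
    HardyOne (fun φ => c * a φ) := by
  refine ⟨ha.integrable.const_mul c, fun n hn => ?_⟩
  simp only [mul_assoc]
  rw [integral_const_mul, ha.coeff n hn, mul_zero]

theorem HardyOne.sub {a b : ℝ → ℂ} (ha : HardyOne a) (hb : HardyOne b) :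
    HardyOne (fun φ => a φ - b φ) := by
  simpa [sub_eq_add_neg] using ha.add (hb.const_mul (-1))

theorem hardyOne_const (c : ℂ) : HardyOne (fun _ => c) := by
  refine ⟨integrable_const c, fun n hn => ?_⟩
  rw [integral_const_mul]
  have hn' : (n : ℂ) * Complex.I ≠ 0 := by simp [hn.ne']
  have : ∫ φ : ℝ, Complex.exp (n * (φ * Complex.I)) ∂circ = 0 := by
    rw [circ, ← integral_Ioc_eq_integral_Ioo,
      ← intervalIntegral.integral_of_le (by linarith [Real.pi_pos])]
    have h2 : ∀ φ : ℝ, Complex.exp (n * (φ * Complex.I)) = Complex.exp (n * Complex.I * φ) :=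
      fun φ => by ring_nf
    simp only [h2]
    rw [integral_exp_mul_complex hn', div_eq_zero_iff]
    left
    rw [sub_eq_zero, Complex.exp_eq_exp_iff_exists_int]
    exact ⟨n, by push_cast; ring⟩
  rw [this, mul_zero]

/-- Shifting down by one index keeps a function with vanishing mean in the class. -/
theorem HardyOne.sin_mul {a : ℝ → ℂ} (ha : HardyOne a) (h0 : ∫ φ, a φ ∂circ = 0) :
    HardyOne (fun φ : ℝ => Real.sin φ * a φ) := by
  refine ⟨?_, fun n hn => ?_⟩
  · refine ha.integrable.bdd_mul (c := 1) (by fun_prop) (ae_of_all _ fun φ => ?_)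
    rw [Complex.norm_real]
    exact Real.abs_sin_le_one φ
  · obtain ⟨m, rfl⟩ : ∃ m, n = m + 1 := ⟨n - 1, by omega⟩
    -- Multiplication by `sin` shifts the index by ±1; for `m = 0` the lower shift lands on the
    -- mean, which is where `h0` enters.
    have h1 : ∀ φ : ℝ, Real.sin φ * a φ * Complex.exp ((m + 1 : ℕ) * (φ * Complex.I)) =
        Complex.I / 2 * (a φ * Complex.exp (m * (φ * Complex.I))) -
          Complex.I / 2 * (a φ * Complex.exp ((m + 2 : ℕ) * (φ * Complex.I))) := by
      intro φ
      rw [Complex.ofReal_sin, Complex.sin]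
      simp only [Complex.exp_nat_mul, neg_mul, Complex.exp_neg, pow_succ]
      field_simp
    simp only [h1]
    rw [integral_sub ((integrable_mul_exp_nat ha.integrable _).const_mul _)
      ((integrable_mul_exp_nat ha.integrable _).const_mul _), integral_const_mul,
      integral_const_mul, ha.coeff (m + 2) (by omega)]
    rcases Nat.eq_zero_or_pos m with rfl | hm
    · simp [h0]
    · rw [ha.coeff m hm]; simp

/-! ### Splitting L² functions into analytic and reflected analytic parts. -/

theorem measurePreserving_neg_circ : MeasurePreserving (fun x : ℝ => -x) circ circ := by
  have h := (Measure.measurePreserving_neg (volume : Measure ℝ)).restrict_preimage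
    (s := Ioo (-Real.pi) Real.pi) measurableSet_Ioo
  have h2 : (fun x : ℝ => -x) ⁻¹' Ioo (-Real.pi) Real.pi = Ioo (-Real.pi) Real.pi := by
    ext x; simp [and_comm, neg_lt]
  rw [h2] at h
  exact h

theorem integral_comp_neg_circ (h : ℝ → ℂ) : ∫ φ, h (-φ) ∂circ = ∫ φ, h φ ∂circ :=
  measurePreserving_neg_circ.integral_comp (MeasurableEquiv.neg ℝ).measurableEmbedding h

theorem integrable_comp_neg_circ {h : ℝ → ℂ} (hh : Integrable h circ) :
    Integrable (fun φ => h (-φ)) circ :=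
  (measurePreserving_neg_circ.integrable_comp_emb
    (MeasurableEquiv.neg ℝ).measurableEmbedding).2 hh

theorem norm_exp_int_mul_I (n : ℤ) (φ : ℝ) :
    ‖Complex.exp (n * (φ * Complex.I))‖ = 1 := by
  rw [Complex.exp_int_mul, norm_zpow, Complex.norm_exp_ofReal_mul_I, one_zpow]

theorem memLp_exp_int (n : ℤ) :
    MemLp (fun φ : ℝ => Complex.exp (n * (φ * Complex.I))) 2 circ :=
  MemLp.of_bound (by fun_prop) 1 (ae_of_all _ fun φ => (norm_exp_int_mul_I n φ).le)

/-- The trigonometric monomial of index `n` as an element of `L²(-π, π)`. -/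
def trigLp (n : ℤ) : Lp ℂ 2 circ := (memLp_exp_int n).toLp

theorem inner_trigLp (n : ℤ) (g : Lp ℂ 2 circ) :
    inner ℂ (trigLp n) g = ∫ φ, g φ * Complex.exp ((-n : ℤ) * (φ * Complex.I)) ∂circ := by
  rw [L2.inner_def]
  refine integral_congr_ae ?_
  filter_upwards [(memLp_exp_int n).coeFn_toLp] with φ hφ
  rw [RCLike.inner_apply, trigLp, hφ, ← Complex.exp_conj]
  simp

theorem inner_trigLp_of_lt {m n : ℤ} (h : m < n) : inner ℂ (trigLp m) (trigLp n) = 0 := by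
  rw [inner_trigLp]
  have := (hardyOne_const 1).coeff (n - m).toNat (by omega)
  rw [← this]
  refine integral_congr_ae ?_
  filter_upwards [(memLp_exp_int n).coeFn_toLp] with φ hφ
  have hnm : (((n - m).toNat : ℕ) : ℂ) = (n : ℂ) - m := by
    have : (((n - m).toNat : ℕ) : ℤ) = n - m := by omega
    exact_mod_cast congrArg (Int.cast (R := ℂ)) this
  rw [trigLp, hφ, ← Complex.exp_add, one_mul, hnm]
  push_cast
  ring_nf

/-- Project orthogonally to the span `K` of the negative exponentials. The component in `Kᗮ` is of
Hardy type by definition. The other one is orthogonal to `Kᗮ`, which contains every nonnegative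
exponential, so its reflection is of Hardy type. Completeness of the trigonometric system is not
needed. -/
theorem exists_hardyOne_add {h : ℝ → ℂ} (hh : MemLp h 2 circ) :
    ∃ a b : ℝ → ℂ, HardyOne a ∧ HardyOne b ∧ ∀ᵐ φ ∂circ, h φ = a φ + b (-φ) := by
  let K : Submodule ℂ (Lp ℂ 2 circ) := Submodule.span ℂ (trigLp '' Iio 0)
  obtain ⟨x, hx, y, hy, hxy⟩ := Kᗮ.exists_add_mem_mem_orthogonal hh.toLp
  have hK : ∀ n : ℤ, n < 0 → trigLp n ∈ K := fun n hn =>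
    Submodule.subset_span ⟨n, hn, rfl⟩
  have hK' : ∀ n : ℤ, 0 ≤ n → trigLp n ∈ Kᗮ := fun n hn => by
    rw [Submodule.mem_orthogonal]
    intro u hu
    induction hu using Submodule.span_induction with
    | mem u hu =>
      obtain ⟨m, hm, rfl⟩ := hu
      exact inner_trigLp_of_lt (lt_of_lt_of_le hm hn)
    | zero => simp
    | add u v _ _ hu hv => rw [inner_add_left, hu, hv, add_zero]
    | smul c u _ hu => rw [inner_smul_left, hu, mul_zero]
  have hint : ∀ z : Lp ℂ 2 circ, Integrable z circ := fun z =>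
    (Lp.memLp z).integrable (by norm_num)
  refine ⟨x, fun φ => y (-φ), ⟨hint x, fun n hn => ?_⟩,
    ⟨integrable_comp_neg_circ (hint y), fun n hn => ?_⟩, ?_⟩
  · have := Submodule.inner_right_of_mem_orthogonal (hK (-n) (by omega)) hx
    rw [inner_trigLp] at this
    simpa using this
  · have := Submodule.inner_right_of_mem_orthogonal (hK' n (by omega)) hy
    rw [inner_trigLp] at this
    rw [← this, ← integral_comp_neg_circ]
    refine integral_congr_ae (ae_of_all _ fun φ => ?_)
    simp
  · filter_upwards [hh.coeFn_toLp, Lp.coeFn_add x y] with φ h1 h2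
    rw [neg_neg, ← h1, hxy, h2, Pi.add_apply]

theorem ae_circ_neg {p : ℝ → Prop} (h : ∀ᵐ φ ∂circ, p φ) : ∀ᵐ φ ∂circ, p (-φ) :=
  measurePreserving_neg_circ.quasiMeasurePreserving.ae h

theorem exists_hardyOne_of_even {h : ℝ → ℂ} (hh : MemLp h 2 circ) (he : ∀ φ, h (-φ) = h φ) :
    ∃ a : ℝ → ℂ, HardyOne a ∧ ∀ᵐ φ ∂circ, h φ = a φ + a (-φ) := by
  obtain ⟨a, b, ha, hb, hab⟩ := exists_hardyOne_add hh
  refine ⟨fun φ => 1 / 2 * (a φ + b φ), (ha.add hb).const_mul _, ?_⟩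
  filter_upwards [hab, ae_circ_neg hab] with φ h1 h2
  rw [he, neg_neg] at h2
  linear_combination (1 / 2) * h1 + (1 / 2) * h2

theorem circ_real_univ : circ.real univ = 2 * Real.pi := by
  rw [circ, measureReal_restrict_apply_univ, Real.volume_real_Ioo_of_le] <;>
    linarith [Real.pi_pos]

theorem exists_hardyOne_of_odd {h : ℝ → ℂ} (hh : MemLp h 2 circ) (ho : ∀ φ, h (-φ) = -h φ) :
    ∃ a : ℝ → ℂ, HardyOne a ∧ ∫ φ, a φ ∂circ = 0 ∧ ∀ᵐ φ ∂circ, h φ = a φ - a (-φ) := by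
  obtain ⟨a, b, ha, hb, hab⟩ := exists_hardyOne_add hh
  have hd := (ha.sub hb).const_mul (1 / 2)
  set d : ℝ → ℂ := fun φ => 1 / 2 * (a φ - b φ) with hd_def
  -- A constant cancels in `a φ - a (-φ)`, so the mean can be removed freely.
  set m : ℂ := (∫ φ, d φ ∂circ) / circ.real univ with hm
  refine ⟨fun φ => d φ - m, hd.sub (hardyOne_const m), ?_, ?_⟩
  · rw [integral_sub hd.integrable (integrable_const m), integral_const, Complex.real_smul, hm]
    have : (circ.real univ : ℂ) ≠ 0 := by
      rw [circ_real_univ]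
      exact_mod_cast (by positivity : (2 * Real.pi) ≠ 0)
    field_simp
    ring
  · filter_upwards [hab, ae_circ_neg hab] with φ h1 h2
    rw [ho, neg_neg] at h2
    simp only [hd_def]
    linear_combination (1 / 2) * h1 - (1 / 2) * h2

/-! ### Lebesgue points and kernels dominated by the Poisson kernel. -/

/-- `x` is a Lebesgue point of `G`. -/
def IsLebesguePoint (G : ℝ → ℂ) (x : ℝ) : Prop :=
  Tendsto (fun r : ℝ => (∫ t in Metric.closedBall x r, ‖G t - G x‖) / r) (𝓝[>] 0) (𝓝 0)

theorem ae_isLebesguePoint {G : ℝ → ℂ} (hG : Integrable G) : ∀ᵐ x, IsLebesguePoint G x := by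
  filter_upwards [IsUnifLocDoublingMeasure.ae_tendsto_average_norm_sub volume
    hG.locallyIntegrable 1] with x hx
  have h := hx (l := 𝓝[>] (0 : ℝ)) (fun _ => x) (fun r => r) tendsto_id
    (by
      filter_upwards [self_mem_nhdsWithin] with r hr
      rw [one_mul]
      exact Metric.mem_closedBall_self (le_of_lt hr))
  have h2 := h.const_mul 2
  rw [mul_zero] at h2
  refine h2.congr' ?_
  filter_upwards [self_mem_nhdsWithin] with r hr
  have hr : 0 < r := hr
  rw [setAverage_eq, Real.closedBall_eq_Icc, Real.volume_real_Icc_of_le (by linarith), smul_eq_mul,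
    show x + r - (x - r) = 2 * r by ring]
  field_simp

/-- Dyadic domination of the Poisson kernel by multiples of indicators of balls of radius `2^j η`,
which reduces its integrals to averages over balls. -/
theorem div_sq_add_sq_le_tsum {η u : ℝ} (hη : 0 < η) :
    η / (η ^ 2 + u ^ 2) ≤ ∑' j : ℕ, 4 * (1 / 4) ^ j / η * (if |u| ≤ 2 ^ j * η then 1 else 0) := by
  have hs0 : Summable fun j : ℕ => 4 * (1 / 4 : ℝ) ^ j / η :=
    ((summable_geometric_of_lt_one (by norm_num) (by norm_num)).mul_left 4).div_const η
  have hnn : ∀ j : ℕ, 0 ≤ 4 * (1 / 4 : ℝ) ^ j / η * (if |u| ≤ 2 ^ j * η then 1 else 0) := by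
    intro j
    split_ifs <;> positivity
  have hs : Summable fun j : ℕ =>
      4 * (1 / 4 : ℝ) ^ j / η * (if |u| ≤ 2 ^ j * η then 1 else 0) := by
    refine Summable.of_nonneg_of_le hnn (fun j => ?_) hs0
    split_ifs
    · rw [mul_one]
    · rw [mul_zero]; positivity
  have hex : ∃ j : ℕ, |u| ≤ 2 ^ j * η := by
    obtain ⟨j, hj⟩ := pow_unbounded_of_one_lt (|u| / η) (by norm_num : (1 : ℝ) < 2)
    exact ⟨j, by rw [div_lt_iff₀ hη] at hj; exact hj.le⟩
  classical
  let j := Nat.find hex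
  have hj : |u| ≤ 2 ^ j * η := Nat.find_spec hex
  refine le_trans ?_ (hs.le_tsum j fun i _ => hnn i)
  rw [if_pos hj, mul_one]
  rw [div_le_div_iff₀ (by positivity) hη]
  -- By minimality of `j`, either `j = 0` or `|u| > 2^(j-1) η`; the single term `j` then already
  -- dominates.
  have key : 1 ≤ 4 * (1 / 4 : ℝ) ^ j ∨ (2 ^ j * η) ^ 2 ≤ 4 * u ^ 2 := by
    rcases Nat.eq_zero_or_pos j with h0 | h0
    · left; rw [h0]; norm_num
    · right
      obtain ⟨i, hi⟩ : ∃ i, j = i + 1 := ⟨j - 1, by omega⟩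
      have : ¬ |u| ≤ 2 ^ i * η := Nat.find_min hex (by omega)
      push Not at this
      have h2 := pow_le_pow_left₀ (by positivity) this.le 2
      rw [sq_abs] at h2
      rw [hi]
      calc (2 ^ (i + 1) * η) ^ 2 = 4 * (2 ^ i * η) ^ 2 := by ring
        _ ≤ 4 * u ^ 2 := by linarith
  rcases key with h | h
  · nlinarith [sq_nonneg u, sq_nonneg η]
  · have h4 : (1 / 4 : ℝ) ^ j * (2 ^ j) ^ 2 = 1 := by
      rw [← pow_mul, mul_comm j 2, pow_mul, ← mul_pow]; norm_num
    have h5 : 0 ≤ (1 / 4 : ℝ) ^ j := by positivity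
    have h6 : η * η = (1 / 4 : ℝ) ^ j * (2 ^ j * η) ^ 2 := by
      rw [mul_pow, ← mul_assoc, h4]; ring
    rw [h6]
    nlinarith [mul_le_mul_of_nonneg_left h h5, mul_nonneg h5 (sq_nonneg η)]

/-- The dyadic bound gives a series of averages `A(2^j η) / (2^j η)` with geometric weights `4 ·
2^{-j}`. Each average tends to 0 and all are uniformly bounded, so dominated convergence for series
applies. -/
theorem tendsto_integral_mul_div_sq_add_sq {D : ℝ → ℝ} (hD : Integrable D) (hD0 : ∀ t, 0 ≤ D t)
    {x : ℝ}
    (hx : Tendsto (fun r : ℝ => (∫ t in Metric.closedBall x r, D t) / r) (𝓝[>] 0) (𝓝 0)) :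
    Tendsto (fun η : ℝ => ∫ t, D t * (η / (η ^ 2 + (t - x) ^ 2))) (𝓝[>] 0) (𝓝 0) := by
  set A : ℝ → ℝ := fun r => ∫ t in Metric.closedBall x r, D t with hA
  have hA0 : ∀ r, 0 ≤ A r := fun r => integral_nonneg hD0
  have hAle : ∀ r, A r ≤ ∫ t, D t := fun r =>
    setIntegral_le_integral hD (ae_of_all _ hD0)
  -- Small radii are controlled by the limit hypothesis, large ones by the total mass of `D`.
  obtain ⟨M, hM⟩ : ∃ M, ∀ r > 0, A r / r ≤ M := by
    have h1 : ∀ᶠ r in 𝓝[>] (0 : ℝ), A r / r < 1 := hx.eventually (gt_mem_nhds one_pos)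
    obtain ⟨r₀, hr₀, h2⟩ := mem_nhdsGT_iff_exists_Ioo_subset.1 h1
    have hr₀ : 0 < r₀ := hr₀
    refine ⟨max 1 ((∫ t, D t) / r₀), fun r hr => ?_⟩
    rcases lt_or_ge r r₀ with h | h
    · exact le_max_of_le_left (le_of_lt (h2 ⟨hr, h⟩))
    · refine le_max_of_le_right ?_
      exact (div_le_div_of_nonneg_right (hAle r) hr.le).trans
        (div_le_div_of_nonneg_left (integral_nonneg hD0) hr₀ h)
  have hM0 : 0 ≤ M := (div_nonneg (hA0 1) zero_le_one).trans (hM 1 one_pos)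
  have hterm : ∀ η > 0, ∀ j : ℕ, 4 * (1 / 4 : ℝ) ^ j / η * A (2 ^ j * η) =
      4 * (1 / 2) ^ j * (A (2 ^ j * η) / (2 ^ j * η)) := by
    intro η hη j
    have : (1 / 4 : ℝ) ^ j = (1 / 2) ^ j * (1 / 2) ^ j := by rw [← mul_pow]; norm_num
    rw [this, div_pow, one_pow]
    field_simp
  have hgeo : Summable fun j : ℕ => 4 * (1 / 2 : ℝ) ^ j * M :=
    ((summable_geometric_of_lt_one (by norm_num) (by norm_num)).mul_left 4).mul_right M
  have hlim : Tendsto (fun η : ℝ => ∑' j : ℕ, 4 * (1 / 2 : ℝ) ^ j * (A (2 ^ j * η) / (2 ^ j * η)))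
      (𝓝[>] 0) (𝓝 (∑' _ : ℕ, (0 : ℝ))) := by
    refine tendsto_tsum_of_dominated_convergence hgeo (fun j => ?_) ?_
    · have h1 : Tendsto (fun η : ℝ => 2 ^ j * η) (𝓝[>] 0) (𝓝[>] 0) := by
        refine tendsto_nhdsWithin_iff.2 ⟨?_, ?_⟩
        · have : Tendsto (fun η : ℝ => 2 ^ j * η) (𝓝 0) (𝓝 (2 ^ j * 0)) :=
            (continuous_const.mul continuous_id).tendsto 0
          rw [mul_zero] at this
          exact this.mono_left nhdsWithin_le_nhds
        · filter_upwards [self_mem_nhdsWithin] with η hη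
          have hη : 0 < η := hη
          exact mem_Ioi.2 (by positivity)
      have := (hx.comp h1).const_mul (4 * (1 / 2 : ℝ) ^ j)
      rw [mul_zero] at this
      exact this
    · filter_upwards [self_mem_nhdsWithin] with η hη j
      have hη : 0 < η := hη
      have hp : 0 < 2 ^ j * η := by positivity
      rw [Real.norm_of_nonneg (mul_nonneg (by positivity) (div_nonneg (hA0 _) hp.le))]
      exact mul_le_mul_of_nonneg_left (hM _ hp) (by positivity)
  rw [tsum_zero] at hlim
  refine tendsto_of_tendsto_of_tendsto_of_le_of_le' tendsto_const_nhds hlim ?_ ?_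
  · filter_upwards [self_mem_nhdsWithin] with η hη
    have hη : 0 < η := hη
    exact integral_nonneg fun t => mul_nonneg (hD0 t) (by positivity)
  · filter_upwards [self_mem_nhdsWithin] with η hη
    have hη : 0 < η := hη
    set F : ℕ → ℝ → ℝ := fun j t =>
      4 * (1 / 4 : ℝ) ^ j / η * (Metric.closedBall x (2 ^ j * η)).indicator D t with hF
    have hFi : ∀ j, Integrable (F j) := fun j =>
      (hD.indicator Metric.isClosed_closedBall.measurableSet).const_mul _
    have hFint : ∀ j, ∫ t, F j t = 4 * (1 / 2) ^ j * (A (2 ^ j * η) / (2 ^ j * η)) := fun j => by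
      rw [hF, integral_const_mul, integral_indicator Metric.isClosed_closedBall.measurableSet,
        ← hterm η hη j]
    have hFnn : ∀ j t, 0 ≤ F j t := fun j t =>
      mul_nonneg (by positivity) (indicator_nonneg (fun t _ => hD0 t) t)
    have hFs : Summable fun j => ∫ t, ‖F j t‖ := by
      simp only [Real.norm_of_nonneg (hFnn _ _), hFint]
      refine Summable.of_nonneg_of_le (fun j => ?_) (fun j => ?_) hgeo
      · have := hA0 (2 ^ j * η); positivity
      · exact mul_le_mul_of_nonneg_left (hM _ (by positivity)) (by positivity)
    have hsum := hasSum_integral_of_summable_integral_norm hFi hFs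
    have hle : ∀ t, D t * (η / (η ^ 2 + (t - x) ^ 2)) ≤ ∑' j, F j t := by
      intro t
      refine (mul_le_mul_of_nonneg_left (div_sq_add_sq_le_tsum (u := t - x) hη) (hD0 t)).trans ?_
      rw [← tsum_mul_left]
      refine le_of_eq (tsum_congr fun j => ?_)
      simp only [hF, indicator, Metric.mem_closedBall, Real.dist_eq]
      split_ifs <;> ring
    have hgeo' : Summable fun j : ℕ => 4 * (1 / 4 : ℝ) ^ j / η :=
      ((summable_geometric_of_lt_one (by norm_num) (by norm_num)).mul_left 4).div_const η
    have hFle : ∀ j t, F j t ≤ 4 * (1 / 4 : ℝ) ^ j / η * D t := fun j t =>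
      mul_le_mul_of_nonneg_left (indicator_le_self' (fun t _ => hD0 t) t) (by positivity)
    have hFsum : ∀ t, Summable fun j => F j t := fun t =>
      Summable.of_nonneg_of_le (fun j => hFnn j t) (fun j => hFle j t) (hgeo'.mul_right (D t))
    have hint : Integrable fun t => ∑' j, F j t := by
      refine (hD.const_mul (∑' j : ℕ, 4 * (1 / 4 : ℝ) ^ j / η)).mono' ?_ (ae_of_all _ fun t => ?_)
      · refine aestronglyMeasurable_of_tendsto_ae atTop
          (f := fun n t => ∑ j ∈ Finset.range n, F j t) (fun n => ?_)
          (ae_of_all _ fun t => (hFsum t).hasSum.tendsto_sum_nat)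
        exact (integrable_finsetSum _ fun j _ => hFi j).aestronglyMeasurable
      · rw [Real.norm_of_nonneg (tsum_nonneg fun j => hFnn j t), ← tsum_mul_right]
        exact (hFsum t).tsum_le_tsum (fun j => hFle j t) (hgeo'.mul_right (D t))
    calc _ ≤ ∫ t, ∑' j, F j t :=
          integral_mono_of_nonneg (ae_of_all _ fun t => mul_nonneg (hD0 t) (by positivity)) hint
            (ae_of_all _ hle)
      _ = ∑' j, ∫ t, F j t := hsum.tsum_eq.symm
      _ = _ := tsum_congr hFint

/-- Convergence at a Lebesgue point for a family of kernels dominated by the Poisson kernel. -/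
theorem IsLebesguePoint.tendsto_integral_mul {G : ℝ → ℂ} {x : ℝ} (hx : IsLebesguePoint G x)
    (hG : Integrable G) {s : Set ℝ} (hs : MeasurableSet s) (hsx : s ∈ 𝓝 x) (hsv : volume s ≠ ⊤)
    {K : ℝ → ℝ → ℂ} {c : ℝ} {κ : ℂ}
    (hKm : ∀ᶠ η in 𝓝[>] (0 : ℝ), AEStronglyMeasurable (K η))
    (hKb : ∀ᶠ η in 𝓝[>] (0 : ℝ), ∀ t, ‖K η t‖ ≤ c * (η / (η ^ 2 + (t - x) ^ 2)))
    (hKs : Tendsto (fun η => ∫ t in s, K η t) (𝓝[>] 0) (𝓝 κ)) :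
    Tendsto (fun η => ∫ t, G t * K η t) (𝓝[>] 0) (𝓝 (κ * G x)) := by
  -- Near `x` this is the constant `G x`, so `G - G₀` satisfies the ball condition at `x`; the part
  -- coming from `G₀` has its limit supplied by `hKs`.
  set G₀ : ℝ → ℂ := s.indicator fun _ => G x with hG₀
  have hG₀i : Integrable G₀ := by
    rw [hG₀, integrable_indicator_iff hs]
    exact integrableOn_const hsv
  have hD := (hG.sub hG₀i).norm
  have hDx : Tendsto (fun r : ℝ => (∫ t in Metric.closedBall x r, ‖(G - G₀) t‖) / r)
      (𝓝[>] 0) (𝓝 0) := by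
    refine hx.congr' ?_
    obtain ⟨r₀, hr₀, hball⟩ := Metric.mem_nhds_iff.1 hsx
    filter_upwards [Ioo_mem_nhdsGT hr₀] with r hr
    congr 1
    refine setIntegral_congr_fun Metric.isClosed_closedBall.measurableSet fun t ht => ?_
    have : t ∈ s := hball (lt_of_le_of_lt ht hr.2)
    simp [hG₀, this]
  have hmain := (tendsto_integral_mul_div_sq_add_sq hD (fun t => norm_nonneg _) hDx).const_mul c
  rw [mul_zero] at hmain
  have hbdd : ∀ᶠ η in 𝓝[>] (0 : ℝ), ∀ t, ‖K η t‖ ≤ |c| / η := by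
    filter_upwards [hKb, self_mem_nhdsWithin] with η hη hη0 t
    have hη0 : 0 < η := hη0
    refine (hη t).trans ?_
    have h1 : η / (η ^ 2 + (t - x) ^ 2) ≤ 1 / η := by
      rw [div_le_div_iff₀ (by positivity) hη0]
      nlinarith [sq_nonneg (t - x)]
    calc c * (η / (η ^ 2 + (t - x) ^ 2)) ≤ |c| * (1 / η) :=
          mul_le_mul (le_abs_self c) h1 (by positivity) (abs_nonneg c)
      _ = _ := by ring
  have hdiff : Tendsto (fun η => ∫ t, (G - G₀) t * K η t) (𝓝[>] 0) (𝓝 0) := by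
    refine squeeze_zero_norm' ?_ hmain
    filter_upwards [hKb, self_mem_nhdsWithin] with η hη hη0
    have hη0 : 0 < η := hη0
    refine (norm_integral_le_integral_norm _).trans ?_
    rw [← integral_const_mul]
    refine integral_mono_of_nonneg (ae_of_all _ fun t => norm_nonneg _) ?_ (ae_of_all _ fun t => ?_)
    · refine Integrable.const_mul ?_ c
      refine hD.mul_bdd (c := 1 / η) ?_ (ae_of_all _ fun t => ?_)
      · refine Continuous.aestronglyMeasurable ?_
        refine continuous_const.div (by fun_prop) fun t => ?_
        positivity
      · rw [Real.norm_of_nonneg (by positivity), div_le_div_iff₀ (by positivity) hη0]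
        nlinarith [sq_nonneg (t - x)]
    · simp only [norm_mul]
      calc _ ≤ ‖(G - G₀) t‖ * (c * (η / (η ^ 2 + (t - x) ^ 2))) :=
            mul_le_mul_of_nonneg_left (hη t) (norm_nonneg _)
        _ = _ := by ring
  have hsum := hdiff.add (hKs.mul_const (G x))
  rw [zero_add] at hsum
  refine hsum.congr' ?_
  filter_upwards [hbdd, hKm] with η hη hηm
  have h1 : ∀ t, G t * K η t = (G - G₀) t * K η t + G₀ t * K η t := fun t => by
    simp only [Pi.sub_apply]; ring
  simp only [h1]
  rw [integral_add ((hG.sub hG₀i).mul_bdd hηm (ae_of_all _ hη))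
    (hG₀i.mul_bdd hηm (ae_of_all _ hη))]
  congr 1
  rw [← integral_mul_const, ← integral_indicator hs]
  refine integral_congr_ae (ae_of_all _ fun t => ?_)
  simp only [hG₀, indicator]
  split_ifs <;> ring

/-! ### The Poisson kernel of the disc and radial limits. -/

/-- The Poisson kernel of the unit disc at the interior point `v` and the boundary point
`exp (i φ)`. -/
def poisson (v : ℂ) (φ : ℝ) : ℂ :=
  v * Complex.exp (-(φ * Complex.I)) / (1 - v * Complex.exp (-(φ * Complex.I))) +
    (1 - (starRingEnd ℂ) v * Complex.exp (φ * Complex.I))⁻¹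

theorem norm_mul_exp_neg (v : ℂ) (φ : ℝ) : ‖v * Complex.exp (-(φ * Complex.I))‖ = ‖v‖ := by
  rw [norm_mul, ← neg_mul, ← Complex.ofReal_neg, Complex.norm_exp_ofReal_mul_I, mul_one]

theorem norm_mul_exp (v : ℂ) (φ : ℝ) : ‖v * Complex.exp (φ * Complex.I)‖ = ‖v‖ := by
  rw [norm_mul, Complex.norm_exp_ofReal_mul_I, mul_one]

theorem one_sub_ne_zero_of_norm_lt {q : ℂ} (hq : ‖q‖ < 1) : 1 - q ≠ 0 := by
  intro h
  rw [sub_eq_zero] at h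
  rw [← h, norm_one] at hq
  exact lt_irrefl _ hq

theorem norm_inv_one_sub_le {q : ℂ} (hq : ‖q‖ < 1) : ‖(1 - q)⁻¹‖ ≤ (1 - ‖q‖)⁻¹ := by
  rw [norm_inv]
  refine inv_anti₀ (by linarith) ?_
  have := norm_sub_norm_le 1 q
  rwa [norm_one] at this

theorem continuous_inv_one_sub_mul_exp {v : ℂ} (hv : ‖v‖ < 1) :
    Continuous fun φ : ℝ => (1 - v * Complex.exp (φ * Complex.I))⁻¹ :=
  Continuous.inv₀ (by fun_prop) fun φ => one_sub_ne_zero_of_norm_lt (by rwa [norm_mul_exp])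

theorem continuous_inv_one_sub_mul_exp_neg {v : ℂ} (hv : ‖v‖ < 1) :
    Continuous fun φ : ℝ => (1 - v * Complex.exp (-(φ * Complex.I)))⁻¹ :=
  Continuous.inv₀ (by fun_prop) fun φ => one_sub_ne_zero_of_norm_lt (by rwa [norm_mul_exp_neg])

theorem continuous_poisson {v : ℂ} (hv : ‖v‖ < 1) : Continuous (poisson v) := by
  unfold poisson
  simp only [div_eq_mul_inv]
  exact (Continuous.mul (by fun_prop) (continuous_inv_one_sub_mul_exp_neg hv)).add
    (continuous_inv_one_sub_mul_exp (by rwa [RCLike.norm_conj]))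

theorem norm_poisson {v : ℂ} (hv : ‖v‖ < 1) (φ : ℝ) :
    ‖poisson v φ‖ = (1 - ‖v‖ ^ 2) / ‖1 - v * Complex.exp (-(φ * Complex.I))‖ ^ 2 := by
  have hq : ‖v * Complex.exp (-(φ * Complex.I))‖ < 1 := by rwa [norm_mul_exp_neg]
  have hc : (starRingEnd ℂ) v * Complex.exp (φ * Complex.I) =
      (starRingEnd ℂ) (v * Complex.exp (-(φ * Complex.I))) := by
    rw [map_mul, ← Complex.exp_conj]
    simp
  have hn : ‖v‖ = ‖v * Complex.exp (-(φ * Complex.I))‖ := (norm_mul_exp_neg v φ).symm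
  rw [poisson, hc, hn]
  set q := v * Complex.exp (-(φ * Complex.I))
  have h1 : 1 - q ≠ 0 := one_sub_ne_zero_of_norm_lt hq
  have h2 : 1 - (starRingEnd ℂ) q ≠ 0 :=
    one_sub_ne_zero_of_norm_lt (by rwa [RCLike.norm_conj])
  have h3 : q / (1 - q) + (1 - (starRingEnd ℂ) q)⁻¹ =
      (((1 - ‖q‖ ^ 2) / ‖1 - q‖ ^ 2 : ℝ) : ℂ) := by
    have h4 : ((‖1 - q‖ ^ 2 : ℝ) : ℂ) = (1 - q) * (1 - (starRingEnd ℂ) q) := by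
      rw [Complex.ofReal_pow, ← Complex.mul_conj', map_sub, map_one]
    have h5 : ((‖q‖ ^ 2 : ℝ) : ℂ) = q * (starRingEnd ℂ) q := by
      rw [Complex.ofReal_pow, ← Complex.mul_conj']
    rw [Complex.ofReal_div, h4, Complex.ofReal_sub, h5]
    field_simp
    push_cast
    ring
  rw [h3, Complex.norm_real, Real.norm_of_nonneg]
  have : ‖q‖ ^ 2 ≤ 1 := by nlinarith [norm_nonneg q]
  exact div_nonneg (by linarith) (sq_nonneg _)

theorem HardyOne.integrable_mul_inv_one_sub {a : ℝ → ℂ} (ha : HardyOne a) {v : ℂ} (hv : ‖v‖ < 1) :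
    Integrable (fun φ : ℝ => a φ * (1 - v * Complex.exp (φ * Complex.I))⁻¹) circ := by
  refine ha.integrable.mul_bdd (c := (1 - ‖v‖)⁻¹)
    (continuous_inv_one_sub_mul_exp hv).aestronglyMeasurable (ae_of_all _ fun φ => ?_)
  rw [← norm_mul_exp v φ]
  exact norm_inv_one_sub_le (by rwa [norm_mul_exp])

theorem HardyOne.integrable_mul_div_one_sub {a : ℝ → ℂ} (ha : HardyOne a) {v : ℂ} (hv : ‖v‖ < 1) :
    Integrable (fun φ : ℝ => a φ * (v * Complex.exp (-(φ * Complex.I)) /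
      (1 - v * Complex.exp (-(φ * Complex.I))))) circ := by
  refine ha.integrable.mul_bdd (c := 1 * (1 - ‖v‖)⁻¹) ?_ (ae_of_all _ fun φ => ?_)
  · simp only [div_eq_mul_inv]
    exact (Continuous.mul (by fun_prop)
      (continuous_inv_one_sub_mul_exp_neg hv)).aestronglyMeasurable
  · rw [div_eq_mul_inv, norm_mul]
    refine mul_le_mul ?_ ?_ (norm_nonneg _) zero_le_one
    · rw [norm_mul_exp_neg]; exact hv.le
    · rw [← norm_mul_exp_neg v φ]
      exact norm_inv_one_sub_le (by rwa [norm_mul_exp_neg])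

theorem HardyOne.integral_mul_poisson {a : ℝ → ℂ} (ha : HardyOne a) {v : ℂ} (hv : ‖v‖ < 1) :
    ∫ φ, a φ * poisson v φ ∂circ =
      ∫ φ : ℝ, a φ * (v * Complex.exp (-(φ * Complex.I)) /
        (1 - v * Complex.exp (-(φ * Complex.I)))) ∂circ + ∫ φ, a φ ∂circ := by
  have hv' : ‖(starRingEnd ℂ) v‖ < 1 := by rwa [RCLike.norm_conj]
  simp only [poisson, mul_add]
  rw [integral_add (ha.integrable_mul_div_one_sub hv) (ha.integrable_mul_inv_one_sub hv'),
    ha.integral_mul_inv_one_sub hv']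

theorem integral_poisson {v : ℂ} (hv : ‖v‖ < 1) : ∫ φ, poisson v φ ∂circ = 2 * Real.pi := by
  have h1 := hardyOne_const 1
  have h := h1.integral_mul_poisson hv
  have h2 := h1.integral_mul_inv_one_sub hv
  have h4 := integral_comp_neg_circ fun φ : ℝ => v * Complex.exp (-(φ * Complex.I)) /
    (1 - v * Complex.exp (-(φ * Complex.I)))
  simp only [one_mul] at h h2
  rw [h, ← h4]
  have h3 : ∀ φ : ℝ, v * Complex.exp (-(((-φ : ℝ) : ℂ) * Complex.I)) /
      (1 - v * Complex.exp (-(((-φ : ℝ) : ℂ) * Complex.I))) =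
      (1 - v * Complex.exp (φ * Complex.I))⁻¹ - 1 := by
    intro φ
    have : 1 - v * Complex.exp (φ * Complex.I) ≠ 0 :=
      one_sub_ne_zero_of_norm_lt (by rwa [norm_mul_exp])
    push_cast
    rw [neg_mul, neg_neg]
    field_simp
    ring
  simp only [h3]
  have hi := h1.integrable_mul_inv_one_sub hv
  simp only [one_mul] at hi
  rw [integral_sub hi (integrable_const 1), h2]
  simp [circ_real_univ]

/-- Concavity of `sin` on `[0, π]` puts it above its chord on `[0, R / 2]`; then use `1 - cos u = 2
sin²(u / 2)`. -/
theorem exists_mul_sq_le_one_sub_cos {R : ℝ} (hR0 : 0 < R) (hR : R < 2 * Real.pi) :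
    ∃ κ > 0, ∀ u, |u| ≤ R → κ * u ^ 2 ≤ 1 - Real.cos u := by
  have hs : 0 < Real.sin (R / 2) := Real.sin_pos_of_pos_of_lt_pi (by linarith) (by linarith)
  refine ⟨2 * (Real.sin (R / 2) / R) ^ 2, by positivity, fun u hu => ?_⟩
  have h1 : Real.sin (R / 2) / R * |u| ≤ Real.sin (|u| / 2) := by
    have hm0 : (0 : ℝ) ∈ Icc 0 Real.pi := ⟨le_rfl, Real.pi_pos.le⟩
    have hm1 : R / 2 ∈ Icc 0 Real.pi := ⟨by linarith, by linarith⟩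
    have h := strictConcaveOn_sin_Icc.concaveOn.2 hm0 hm1
      (sub_nonneg.2 ((div_le_one hR0).2 hu)) (div_nonneg (abs_nonneg u) hR0.le)
      (sub_add_cancel 1 (|u| / R))
    simp only [smul_eq_mul, Real.sin_zero, mul_zero, zero_add] at h
    have e : |u| / R * (R / 2) = |u| / 2 := by field_simp
    rw [e] at h
    calc _ = |u| / R * Real.sin (R / 2) := by ring
      _ ≤ _ := h
  have h2 : 1 - Real.cos u = 2 * Real.sin (|u| / 2) ^ 2 := by
    rw [← Real.cos_abs u, Real.sin_sq_eq_half_sub]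
    ring_nf
  rw [h2, ← sq_abs u]
  have h3 := pow_le_pow_left₀ (by positivity) h1 2
  nlinarith

theorem norm_exp_mul_I_lt_one {τ : ℂ} (h : 0 < τ.im) : ‖Complex.exp (τ * Complex.I)‖ < 1 := by
  rw [Complex.norm_exp]
  simpa using h

theorem exists_norm_poisson_le {θ : ℝ} (hθ : θ ∈ Ioo (-Real.pi) Real.pi) :
    ∃ c, ∀ η ∈ Ioo (0 : ℝ) 1, ∀ φ ∈ Ioo (-Real.pi) Real.pi,
      ‖poisson (Complex.exp ((θ + η * Complex.I) * Complex.I)) φ‖ ≤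
        c * (η / (η ^ 2 + (φ - θ) ^ 2)) := by
  have hθ' : |θ| < Real.pi := abs_lt.2 hθ
  -- For `φ` in `(-π, π)` the difference `φ - θ` stays within `π + |θ| < 2π`, away from the other
  -- zeros of `1 - cos`.
  obtain ⟨κ, hκ, hcos⟩ := exists_mul_sq_le_one_sub_cos (R := Real.pi + |θ|)
    (by positivity) (by linarith)
  -- The `1/4` comes from `1 - e^{-η} ≥ η/2`, the `2κ/3` from `e^{-η} ≥ 1/3`; the 2 in `2 / m`
  -- bounds the numerator.
  set m : ℝ := min (1 / 4) (2 / 3 * κ) with hm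
  have hm0 : 0 < m := lt_min (by norm_num) (by positivity)
  refine ⟨2 / m, fun η hη φ hφ => ?_⟩
  have hη0 : 0 < η := hη.1
  rw [norm_poisson (norm_exp_mul_I_lt_one (by simpa using hη0))]
  have hnorm : ‖Complex.exp ((θ + η * Complex.I) * Complex.I)‖ = Real.exp (-η) := by
    rw [Complex.norm_exp]; simp
  have hden : ‖1 - Complex.exp ((θ + η * Complex.I) * Complex.I) *
      Complex.exp (-(φ * Complex.I))‖ ^ 2 =
      (1 - Real.exp (-η)) ^ 2 + 2 * Real.exp (-η) * (1 - Real.cos (φ - θ)) := by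
    rw [← Complex.exp_add]
    have : (θ + η * Complex.I) * Complex.I + -(φ * Complex.I) =
        ((-η : ℝ) : ℂ) + ((θ - φ : ℝ) : ℂ) * Complex.I := by
      push_cast
      linear_combination (η : ℂ) * Complex.I_mul_I
    rw [this, Complex.exp_add, ← Complex.ofReal_exp, Complex.exp_mul_I, ← Complex.ofReal_cos,
      ← Complex.ofReal_sin, ← Complex.normSq_eq_norm_sq, Complex.normSq_apply]
    simp only [Complex.sub_re, Complex.one_re, Complex.mul_re, Complex.ofReal_re, Complex.add_re,
      Complex.I_re, mul_zero, Complex.ofReal_im, Complex.I_im, mul_one, sub_zero,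
      Complex.sub_im, Complex.one_im, Complex.mul_im, Complex.add_im, zero_mul, sub_self, add_zero,
      zero_add, zero_sub]
    rw [show φ - θ = -(θ - φ) by ring, Real.cos_neg]
    linear_combination Real.exp (-η) ^ 2 * Real.sin_sq_add_cos_sq (θ - φ)
  rw [hnorm, hden]
  have e1 : 1 - Real.exp (-η) ^ 2 ≤ 2 * η := by
    have := Real.add_one_le_exp (-(2 * η))
    rw [← Real.exp_nat_mul]
    push_cast
    rw [show (2 : ℝ) * -η = -(2 * η) by ring]
    linarith
  have e2 : η / 2 ≤ 1 - Real.exp (-η) := by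
    have h1 := Real.add_one_le_exp η
    have h2 : Real.exp (-η) * Real.exp η = 1 := by rw [← Real.exp_add]; simp
    have h3 := Real.exp_pos (-η)
    nlinarith [hη.2]
  have e3 : 1 / 3 ≤ Real.exp (-η) := by
    have h1 : Real.exp η ≤ 3 := (Real.exp_le_exp.2 hη.2.le).trans Real.exp_one_lt_three.le
    rw [Real.exp_neg, one_div]
    exact inv_anti₀ (Real.exp_pos η) h1
  have e4 := hcos (φ - θ) (by
    have : |φ| < Real.pi := abs_lt.2 hφ
    linarith [abs_sub φ θ])
  have e5 : m * (η ^ 2 + (φ - θ) ^ 2) ≤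
      (1 - Real.exp (-η)) ^ 2 + 2 * Real.exp (-η) * (1 - Real.cos (φ - θ)) := by
    have h1 : m * η ^ 2 ≤ (1 - Real.exp (-η)) ^ 2 := by
      have := pow_le_pow_left₀ (by positivity) e2 2
      nlinarith [min_le_left (1 / 4) (2 / 3 * κ), sq_nonneg η]
    have h2 : m * (φ - θ) ^ 2 ≤ 2 * Real.exp (-η) * (1 - Real.cos (φ - θ)) := by
      have h3 : m * (φ - θ) ^ 2 ≤ 2 / 3 * κ * (φ - θ) ^ 2 :=
        mul_le_mul_of_nonneg_right (min_le_right _ _) (sq_nonneg _)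
      have h4 := Real.cos_le_one (φ - θ)
      nlinarith
    linarith
  have hpos : 0 < η ^ 2 + (φ - θ) ^ 2 := by positivity
  calc _ ≤ 2 * η / (m * (η ^ 2 + (φ - θ) ^ 2)) := by
        refine div_le_div₀ (by positivity) e1 (by positivity) e5
    _ = _ := by field_simp

theorem HardyOne.ae_tendsto_integral_mul_poisson {a : ℝ → ℂ} (ha : HardyOne a) :
    ∀ᵐ θ : ℝ ∂circ, Tendsto (fun η : ℝ => ∫ φ, a φ *
      poisson (Complex.exp ((θ + η * Complex.I) * Complex.I)) φ ∂circ) (𝓝[>] 0)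
      (𝓝 (2 * Real.pi * a θ)) := by
  set s : Set ℝ := Ioo (-Real.pi) Real.pi with hs
  have hG : Integrable (s.indicator a) := by
    rw [integrable_indicator_iff measurableSet_Ioo]
    exact ha.integrable
  have h1 : ∀ᵐ θ ∂circ, IsLebesguePoint (s.indicator a) θ :=
    ae_restrict_of_ae (ae_isLebesguePoint hG)
  have h2 : ∀ᵐ θ ∂circ, θ ∈ s := ae_restrict_mem measurableSet_Ioo
  filter_upwards [h1, h2] with θ hL hθ
  obtain ⟨c, hc⟩ := exists_norm_poisson_le hθ
  have hvn : ∀ η : ℝ, 0 < η → ‖Complex.exp ((θ + η * Complex.I) * Complex.I)‖ < 1 :=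
    fun η hη => norm_exp_mul_I_lt_one (by simpa using hη)
  have key := hL.tendsto_integral_mul hG measurableSet_Ioo (Ioo_mem_nhds hθ.1 hθ.2)
    (by simp [Real.volume_Ioo])
    (K := fun η => s.indicator
      (poisson (Complex.exp ((θ + η * Complex.I) * Complex.I)))) (c := max c 0)
    (κ := 2 * Real.pi) ?_ ?_ ?_
  · rw [indicator_of_mem hθ] at key
    refine key.congr fun η => ?_
    rw [circ, ← integral_indicator measurableSet_Ioo]
    refine integral_congr_ae (ae_of_all _ fun φ => ?_)
    by_cases h : φ ∈ s
    · simp [← hs, h]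
    · simp [← hs, h]
  · filter_upwards [self_mem_nhdsWithin] with η hη
    exact (continuous_poisson (hvn η hη)).aestronglyMeasurable.indicator measurableSet_Ioo
  · filter_upwards [Ioo_mem_nhdsGT one_pos] with η hη φ
    have hη0 : 0 < η := hη.1
    by_cases h : φ ∈ s
    · rw [indicator_of_mem h]
      exact (hc η hη φ h).trans (mul_le_mul_of_nonneg_right (le_max_left _ _) (by positivity))
    · rw [indicator_of_notMem h, norm_zero]
      positivity
  · refine tendsto_const_nhds.congr' ?_
    filter_upwards [self_mem_nhdsWithin] with η hη
    rw [setIntegral_indicator measurableSet_Ioo, inter_self]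
    exact (integral_poisson (hvn η hη)).symm

/-! ### The Cauchy kernel in the variable `cos φ`. -/

theorem inv_cos_sub_cos_eq {τ : ℂ} (hτ : 0 < τ.im) (φ : ℝ) :
    (Complex.cos τ - Real.cos φ)⁻¹ = Complex.I / Complex.sin τ *
      (Complex.exp (τ * Complex.I) * Complex.exp (-(φ * Complex.I)) /
        (1 - Complex.exp (τ * Complex.I) * Complex.exp (-(φ * Complex.I))) +
        (1 - Complex.exp (τ * Complex.I) * Complex.exp (φ * Complex.I))⁻¹) := by
  have hv := norm_exp_mul_I_lt_one hτ
  have h1 : 1 - Complex.exp (τ * Complex.I) * Complex.exp (-(φ * Complex.I)) ≠ 0 :=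
    one_sub_ne_zero_of_norm_lt (by rwa [norm_mul_exp_neg])
  have h2 : 1 - Complex.exp (τ * Complex.I) * Complex.exp (φ * Complex.I) ≠ 0 :=
    one_sub_ne_zero_of_norm_lt (by rwa [norm_mul_exp])
  have h3 : 1 - Complex.exp (τ * Complex.I) ^ 2 ≠ 0 :=
    one_sub_ne_zero_of_norm_lt (by
      rw [norm_pow]
      nlinarith [norm_nonneg (Complex.exp (τ * Complex.I))])
  rw [Complex.ofReal_cos, Complex.cos, Complex.cos, Complex.sin]
  simp only [neg_mul, Complex.exp_neg] at *
  set v := Complex.exp (τ * Complex.I)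
  set e := Complex.exp (φ * Complex.I)
  have hv0 : v ≠ 0 := Complex.exp_ne_zero _
  have he0 : e ≠ 0 := Complex.exp_ne_zero _
  have h1' : e - v ≠ 0 := by
    intro h
    apply h1
    rw [sub_eq_zero] at h
    rw [h, mul_inv_cancel₀ hv0, sub_self]
  have hA : (v + v⁻¹) / 2 - (e + e⁻¹) / 2 = (e - v) * (1 - v * e) / (2 * v * e) := by
    field_simp
    ring
  have hB : (v⁻¹ - v) * Complex.I / 2 = (1 - v ^ 2) * Complex.I / (2 * v) := by
    field_simp
  have hC : 1 - v * e⁻¹ = (e - v) / e := by field_simp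
  rw [hA, hB, hC]
  generalize hd : 1 - v * e = d at *
  field_simp
  rw [← hd]
  ring

/-- The Cauchy-type integral of a function of the Hardy class in the variable `cos φ` is a
Poisson integral. -/
theorem HardyOne.integral_mul_inv_cos_sub_cos {a : ℝ → ℂ} (ha : HardyOne a) {τ : ℂ}
    (hτ : 0 < τ.im) :
    Integrable (fun φ : ℝ => a φ * (Complex.cos τ - Real.cos φ)⁻¹) circ ∧
    ∫ φ : ℝ, a φ * (Complex.cos τ - Real.cos φ)⁻¹ ∂circ =
      Complex.I / Complex.sin τ *
        ∫ φ, a φ * poisson (Complex.exp (τ * Complex.I)) φ ∂circ := by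
  have hv := norm_exp_mul_I_lt_one hτ
  have h : ∀ φ : ℝ, a φ * (Complex.cos τ - Real.cos φ)⁻¹ = Complex.I / Complex.sin τ *
      (a φ * (Complex.exp (τ * Complex.I) * Complex.exp (-(φ * Complex.I)) /
        (1 - Complex.exp (τ * Complex.I) * Complex.exp (-(φ * Complex.I)))) +
        a φ * (1 - Complex.exp (τ * Complex.I) * Complex.exp (φ * Complex.I))⁻¹) := by
    intro φ
    rw [inv_cos_sub_cos_eq hτ]
    ring
  simp only [h]
  have i1 := ha.integrable_mul_div_one_sub hv
  have i2 := ha.integrable_mul_inv_one_sub hv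
  refine ⟨(i1.add i2).const_mul _, ?_⟩
  -- The analytic half of the kernel contributes only the mean of `a`, whether built from `v` or
  -- from its conjugate; exchanging the two yields the Poisson kernel.
  rw [integral_const_mul, integral_add i1 i2, ha.integral_mul_inv_one_sub hv,
    ha.integral_mul_poisson hv]

/-! ### The change of variables `y = cos φ`. -/

theorem cos_image_Ioo : Real.cos '' Ioo 0 Real.pi = I := by
  ext x
  constructor
  · rintro ⟨θ, hθ, rfl⟩
    have h0 := Real.sin_pos_of_mem_Ioo hθ
    have := Real.sin_sq_add_cos_sq θ
    constructor <;> nlinarith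
  · rintro ⟨h1, h2⟩
    refine ⟨Real.arccos x, ⟨Real.arccos_pos.2 h2, ?_⟩, Real.cos_arccos h1.le h2.le⟩
    refine lt_of_le_of_ne (Real.arccos_le_pi x) fun h => ?_
    rw [Real.arccos_eq_pi] at h
    linarith

theorem cos_mem_I {θ : ℝ} (hθ : θ ∈ Ioo 0 Real.pi) : Real.cos θ ∈ I :=
  cos_image_Ioo ▸ mem_image_of_mem _ hθ

theorem injOn_cos_Ioo : InjOn Real.cos (Ioo 0 Real.pi) :=
  Real.injOn_cos.mono Ioo_subset_Icc_self

theorem measurableSet_I : MeasurableSet I := measurableSet_Ioo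

theorem abs_neg_sin_of_mem {θ : ℝ} (hθ : θ ∈ Ioo 0 Real.pi) : |-Real.sin θ| = Real.sin θ := by
  rw [abs_neg, abs_of_pos (Real.sin_pos_of_mem_Ioo hθ)]

theorem w_cos {θ : ℝ} (hθ : θ ∈ Ioo 0 Real.pi) : w (Real.cos θ) = Real.sin θ := by
  rw [w, ← Real.sin_sq, Real.sqrt_sq (Real.sin_pos_of_mem_Ioo hθ).le]

theorem integral_I_eq {E : Type*} [NormedAddCommGroup E] [NormedSpace ℝ E] (g : ℝ → E) :
    ∫ y in I, g y = ∫ φ in Ioo 0 Real.pi, Real.sin φ • g (Real.cos φ) := by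
  rw [← cos_image_Ioo, integral_image_eq_integral_abs_deriv_smul measurableSet_Ioo
    (fun θ _ => (Real.hasDerivAt_cos θ).hasDerivWithinAt) injOn_cos_Ioo]
  exact setIntegral_congr_fun measurableSet_Ioo fun θ hθ => by
    simp only [abs_neg_sin_of_mem hθ]

theorem integrableOn_I_iff {E : Type*} [NormedAddCommGroup E] [NormedSpace ℝ E] (g : ℝ → E) :
    IntegrableOn g I ↔ IntegrableOn (fun φ => Real.sin φ • g (Real.cos φ)) (Ioo 0 Real.pi) := by
  rw [← cos_image_Ioo, integrableOn_image_iff_integrableOn_abs_deriv_smul measurableSet_Ioo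
    (fun θ _ => (Real.hasDerivAt_cos θ).hasDerivWithinAt) injOn_cos_Ioo]
  exact integrableOn_congr_fun (fun θ hθ => by simp only [abs_neg_sin_of_mem hθ]) measurableSet_Ioo

/-- Null sets pass both ways because `cos` and, on the open interval, `arccos` are differentiable.
-/
theorem ae_I_iff {p : ℝ → Prop} :
    (∀ᵐ x ∂volume.restrict I, p x) ↔ ∀ᵐ θ ∂volume.restrict (Ioo 0 Real.pi), p (Real.cos θ) := by
  rw [ae_restrict_iff' measurableSet_I, ae_restrict_iff' measurableSet_Ioo, ae_iff, ae_iff]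
  have h1 : {x | ¬(x ∈ I → p x)} = Real.cos '' {θ | ¬(θ ∈ Ioo 0 Real.pi → p (Real.cos θ))} := by
    ext x
    simp only [mem_ofPred_eq, mem_image, Classical.not_imp]
    constructor
    · rintro ⟨hx, hp⟩
      rw [← cos_image_Ioo] at hx
      obtain ⟨θ, hθ, rfl⟩ := hx
      exact ⟨θ, ⟨hθ, hp⟩, rfl⟩
    · rintro ⟨θ, ⟨hθ, hp⟩, rfl⟩
      exact ⟨cos_mem_I hθ, hp⟩
  have h2 : {θ | ¬(θ ∈ Ioo 0 Real.pi → p (Real.cos θ))} =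
      Real.arccos '' {x | ¬(x ∈ I → p x)} := by
    rw [h1, image_image]
    symm
    have : ∀ θ ∈ {θ | ¬(θ ∈ Ioo 0 Real.pi → p (Real.cos θ))},
        Real.arccos (Real.cos θ) = θ := fun θ hθ => by
      simp only [mem_ofPred_eq, Classical.not_imp] at hθ
      exact Real.arccos_cos hθ.1.1.le hθ.1.2.le
    rw [image_congr this, image_id']
  constructor
  · intro h
    rw [h2]
    refine addHaar_image_eq_zero_of_differentiableOn_of_addHaar_eq_zero _ (fun x hx => ?_) h
    simp only [mem_ofPred_eq, Classical.not_imp] at hx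
    exact (Real.differentiableAt_arccos.2 ⟨hx.1.1.ne', hx.1.2.ne⟩).differentiableWithinAt
  · intro h
    rw [h1]
    exact addHaar_image_eq_zero_of_differentiableOn_of_addHaar_eq_zero _
      Real.differentiable_cos.differentiableOn h

theorem ae_Ioo_of_ae_circ {p : ℝ → Prop} (h : ∀ᵐ θ ∂circ, p θ) :
    ∀ᵐ θ ∂volume.restrict (Ioo 0 Real.pi), p θ :=
  ae_restrict_of_ae_restrict_of_subset (Ioo_subset_Ioo_left (by linarith [Real.pi_pos])) h

theorem integrableOn_half_of_circ {h : ℝ → ℂ} (hh : Integrable h circ) :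
    IntegrableOn h (Ioo 0 Real.pi) :=
  IntegrableOn.mono_set (t := Ioo (-Real.pi) Real.pi) hh
    (Ioo_subset_Ioo_left (by linarith [Real.pi_pos]))

theorem integral_half_add_neg {h : ℝ → ℂ} (hh : Integrable h circ) :
    ∫ φ in Ioo 0 Real.pi, (h φ + h (-φ)) = ∫ φ, h φ ∂circ := by
  rw [integral_add (integrableOn_half_of_circ hh)
    (integrableOn_half_of_circ (integrable_comp_neg_circ hh))]
  have hπ := Real.pi_pos
  have hh' : IntegrableOn h (Ioc (-Real.pi) Real.pi) :=
    (integrableOn_Ioc_iff_integrableOn_Ioo).2 hh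
  simp only [circ]
  rw [← integral_Ioc_eq_integral_Ioo, ← integral_Ioc_eq_integral_Ioo,
    ← integral_Ioc_eq_integral_Ioo, ← intervalIntegral.integral_of_le hπ.le,
    ← intervalIntegral.integral_of_le hπ.le, ← intervalIntegral.integral_of_le (by linarith),
    intervalIntegral.integral_comp_neg, neg_zero, add_comm]
  refine intervalIntegral.integral_add_adjacent_intervals ?_ ?_
  · rw [intervalIntegrable_iff_integrableOn_Ioc_of_le (by linarith)]
    exact hh'.mono_set (Ioc_subset_Ioc_right hπ.le)
  · rw [intervalIntegrable_iff_integrableOn_Ioc_of_le hπ.le]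
    exact hh'.mono_set (Ioc_subset_Ioc_left (by linarith))

/-- `g` corresponds on `(-1, 1)` to the even function `φ ↦ a φ + a (-φ)` under `y = cos φ`. -/
def IsEvenLift (g a : ℝ → ℂ) : Prop :=
  ∀ᵐ φ ∂volume.restrict (Ioo 0 Real.pi), Real.sin φ * g (Real.cos φ) = a φ + a (-φ)

theorem IsEvenLift.integrableOn {g a : ℝ → ℂ} (h : IsEvenLift g a) (ha : Integrable a circ) :
    IntegrableOn g I := by
  rw [integrableOn_I_iff]
  refine ((integrableOn_half_of_circ ha).add
    (integrableOn_half_of_circ (integrable_comp_neg_circ ha))).congr ?_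
  filter_upwards [h] with φ hφ
  rw [Complex.real_smul, hφ, Pi.add_apply]

theorem IsEvenLift.integral_mul {g a K : ℝ → ℂ} (h : IsEvenLift g a)
    (hK : Integrable (fun φ => a φ * K (Real.cos φ)) circ) :
    ∫ y in I, g y * K y = ∫ φ, a φ * K (Real.cos φ) ∂circ := by
  rw [integral_I_eq, ← integral_half_add_neg hK]
  refine integral_congr_ae ?_
  filter_upwards [h] with φ hφ
  rw [Complex.real_smul, Real.cos_neg, ← mul_assoc, hφ]
  ring

/-! ### Truncated kernels against conjugate Poisson kernels. -/

/-- The conjugate Poisson kernel of the half plane. -/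
def conjKernel (u Y : ℝ) : ℝ := u / (u ^ 2 + Y ^ 2)

/-- The kernel `1 / u` truncated to `η < |u|`. -/
def truncKernel (η u : ℝ) : ℝ := if η < |u| then 1 / u else 0

theorem conjKernel_neg (u Y : ℝ) : conjKernel (-u) Y = -conjKernel u Y := by
  simp [conjKernel, neg_div]

theorem truncKernel_neg (η u : ℝ) : truncKernel η (-u) = -truncKernel η u := by
  unfold truncKernel
  rw [abs_neg]
  split_ifs
  · rw [div_neg]
  · rw [neg_zero]

theorem abs_conjKernel_sub_le {u u' Y : ℝ} (hY : 0 < Y) :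
    |conjKernel u Y - conjKernel u' Y| ≤ |u - u'| / Y ^ 2 := by
  have h1 : 0 < u ^ 2 + Y ^ 2 := by positivity
  have h2 : 0 < u' ^ 2 + Y ^ 2 := by positivity
  have h3 : conjKernel u Y - conjKernel u' Y =
      (u - u') * (Y ^ 2 - u * u') / ((u ^ 2 + Y ^ 2) * (u' ^ 2 + Y ^ 2)) := by
    unfold conjKernel
    field_simp
    ring
  rw [h3, abs_div, abs_mul, abs_of_pos (mul_pos h1 h2), div_le_div_iff₀ (by positivity)
    (by positivity), mul_assoc]
  refine mul_le_mul_of_nonneg_left ?_ (abs_nonneg _)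
  rw [← abs_of_pos (show 0 < Y ^ 2 by positivity), ← abs_mul,
    abs_of_pos (show 0 < Y ^ 2 by positivity)]
  have hY2 : 0 < Y ^ 2 := by positivity
  refine abs_le.2 ⟨?_, ?_⟩
  · nlinarith [sq_nonneg (u - u'), sq_nonneg (u + u'), sq_nonneg (u * u'), sq_nonneg (Y ^ 2)]
  · nlinarith [sq_nonneg (u - u'), sq_nonneg (u + u'), sq_nonneg (u * u'), sq_nonneg (Y ^ 2)]

theorem sinh_le_two_mul {η : ℝ} (h0 : 0 ≤ η) (h1 : η ≤ 1) : Real.sinh η ≤ 2 * η := by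
  have e1 := (abs_le.1 (Real.abs_exp_sub_one_sub_id_le (x := η) (by rw [abs_of_nonneg h0]; exact h1))).2
  have e2 := Real.add_one_le_exp (-η)
  rw [Real.sinh_eq]
  nlinarith

/-- As `η ≤ sinh η ≤ 2η`, the height `s sinh η` is comparable to the truncation radius, with
constants depending on `s`. The `4` comes from `(2η)²`, the `s²` from `u² + s² η² ≥ s² (u² + η²)`.
-/
theorem abs_conjKernel_sub_truncKernel_le {s η : ℝ} (hs : 0 < s) (hs1 : s ≤ 1)
    (hη : η ∈ Ioo (0 : ℝ) 1) (u : ℝ) :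
    |conjKernel u (s * Real.sinh η) - truncKernel η u| ≤ 4 / s ^ 2 * (η / (η ^ 2 + u ^ 2)) := by
  have hη0 : 0 < η := hη.1
  have hs2 : 0 < s ^ 2 := by positivity
  have hs2' : s ^ 2 ≤ 1 := by nlinarith
  have hsh : η ≤ Real.sinh η := Real.self_le_sinh_iff.2 hη0.le
  have hsh' := sinh_le_two_mul hη0.le hη.2.le
  have hY0 : 0 < s * Real.sinh η := by positivity
  have hlow : s ^ 2 * (η ^ 2 + u ^ 2) ≤ u ^ 2 + (s * Real.sinh η) ^ 2 := by
    rw [mul_pow]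
    have : η ^ 2 ≤ Real.sinh η ^ 2 := pow_le_pow_left₀ hη0.le hsh 2
    nlinarith [sq_nonneg u]
  have hpos : 0 < η ^ 2 + u ^ 2 := by positivity
  have hR : 4 / s ^ 2 * (η / (η ^ 2 + u ^ 2)) = 4 * η / (s ^ 2 * (η ^ 2 + u ^ 2)) := by
    field_simp
  rw [hR]
  unfold conjKernel truncKernel
  split_ifs with h
  · have hu : u ≠ 0 := by
      rintro rfl
      rw [abs_zero] at h
      linarith
    have hu' : 0 < |u| := abs_pos.2 hu
    have e : u / (u ^ 2 + (s * Real.sinh η) ^ 2) - 1 / u =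
        -((s * Real.sinh η) ^ 2 / (u * (u ^ 2 + (s * Real.sinh η) ^ 2))) := by
      have : u ^ 2 + (s * Real.sinh η) ^ 2 ≠ 0 := by positivity
      field_simp
      ring
    rw [e, abs_neg, abs_div, abs_mul, abs_of_pos (show 0 < (s * Real.sinh η) ^ 2 by positivity),
      abs_of_pos (show 0 < u ^ 2 + (s * Real.sinh η) ^ 2 by positivity)]
    have hY : (s * Real.sinh η) ^ 2 ≤ 4 * η ^ 2 := by
      rw [mul_pow]
      have : Real.sinh η ^ 2 ≤ (2 * η) ^ 2 := pow_le_pow_left₀ (by linarith) hsh' 2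
      nlinarith [sq_nonneg (Real.sinh η)]
    calc _ ≤ 4 * η ^ 2 / (η * (s ^ 2 * (η ^ 2 + u ^ 2))) :=
          div_le_div₀ (by positivity) hY (by positivity)
            (mul_le_mul h.le hlow (by positivity) hu'.le)
      _ = _ := by field_simp
  · push Not at h
    rw [sub_zero, abs_div, abs_of_pos (show 0 < u ^ 2 + (s * Real.sinh η) ^ 2 by positivity)]
    exact div_le_div₀ (by positivity) (by linarith) (by positivity) hlow

theorem setIntegral_closedBall_eq_zero_of_odd {k : ℝ → ℂ} (hk : ∀ u, k (-u) = -k u) (x r : ℝ) :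
    ∫ t in Metric.closedBall x r, k (x - t) = 0 := by
  have hm : MeasurableSet (Metric.closedBall x r) := Metric.isClosed_closedBall.measurableSet
  rw [← integral_indicator hm]
  set F := (Metric.closedBall x r).indicator fun t => k (x - t) with hF
  have h1 : ∀ t, F (2 * x - t) = -F t := by
    intro t
    have hiff : 2 * x - t ∈ Metric.closedBall x r ↔ t ∈ Metric.closedBall x r := by
      rw [Metric.mem_closedBall, Metric.mem_closedBall, Real.dist_eq, Real.dist_eq,
        show 2 * x - t - x = -(t - x) by ring, abs_neg]
    by_cases ht : t ∈ Metric.closedBall x r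
    · rw [hF, indicator_of_mem (hiff.2 ht), indicator_of_mem ht, ← hk]
      congr 1
      ring
    · rw [hF, indicator_of_notMem (mt hiff.1 ht), indicator_of_notMem ht, neg_zero]
  have h2 := integral_sub_left_eq_self F volume (2 * x)
  simp only [h1] at h2
  rw [integral_neg] at h2
  linear_combination (-1 / 2 : ℂ) * h2

theorem measurable_truncKernel (η : ℝ) : Measurable (truncKernel η) :=
  Measurable.ite (measurableSet_lt measurable_const continuous_abs.measurable)
    (measurable_const.div measurable_id) measurable_const

theorem abs_truncKernel_le {η : ℝ} (hη : 0 < η) (u : ℝ) : |truncKernel η u| ≤ 1 / η := by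
  unfold truncKernel
  split_ifs with h
  · rw [abs_div, abs_one]
    exact one_div_le_one_div_of_le hη h.le
  · rw [abs_zero]; positivity

theorem continuous_conjKernel {Y : ℝ} (hY : 0 < Y) : Continuous fun u => conjKernel u Y := by
  unfold conjKernel
  exact continuous_id.div (by fun_prop) fun u => by positivity

theorem abs_conjKernel_le {Y : ℝ} (hY : 0 < Y) (u : ℝ) : |conjKernel u Y| ≤ 1 / Y := by
  unfold conjKernel
  rw [abs_div, abs_of_pos (show 0 < u ^ 2 + Y ^ 2 by positivity),
    div_le_div_iff₀ (by positivity) hY, ← sq_abs u]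
  nlinarith [sq_nonneg (|u| - Y), abs_nonneg u]

theorem setIntegral_truncated_eq {g : ℝ → ℂ} (x : ℝ) (η : ℝ) :
    ∫ y in truncated x η, g y / ((x : ℂ) - y) =
      ∫ y, I.indicator g y * (truncKernel η (x - y) : ℂ) := by
  have hm : MeasurableSet (truncated x η) :=
    measurableSet_I.inter (measurableSet_lt measurable_const (by fun_prop : Measurable fun y : ℝ => |y - x|))
  rw [← integral_indicator hm]
  refine integral_congr_ae (ae_of_all _ fun y => ?_)
  simp only [indicator, truncated, mem_ofPred_eq, truncKernel]
  rw [abs_sub_comm x y]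
  by_cases h1 : y ∈ I <;> by_cases h2 : η < |y - x| <;> simp [h1, h2, div_eq_mul_inv]

theorem integrableOn_truncated {g : ℝ → ℂ} (hg : IntegrableOn g I) (x : ℝ) {η : ℝ} (hη : 0 < η) :
    IntegrableOn (fun y => g y / ((x : ℂ) - y)) (truncated x η) := by
  have hm : MeasurableSet (truncated x η) :=
    measurableSet_I.inter (measurableSet_lt measurable_const (by fun_prop : Measurable fun y : ℝ => |y - x|))
  have h1 : IntegrableOn g (truncated x η) := hg.mono_set fun y hy => hy.1
  have h2 : IntegrableOn (fun y => g y * (truncKernel η (x - y) : ℂ)) (truncated x η) := by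
    refine Integrable.mul_bdd (c := 1 / η) h1 ?_ (ae_of_all _ fun y => ?_)
    · exact (Complex.measurable_ofReal.comp
        ((measurable_truncKernel η).comp (by fun_prop))).aestronglyMeasurable
    · rw [Complex.norm_real]
      exact abs_truncKernel_le hη _
  refine h2.congr_fun (fun y hy => ?_) hm
  have : η < |x - y| := by rw [abs_sub_comm]; exact hy.2
  simp [truncKernel, this, div_eq_mul_inv]

/-- At a Lebesgue point the principal value exists as soon as the conjugate Poisson integrals
along a curve orthogonal to the real axis converge. -/
theorem hasPV_of_tendsto_conjKernel {g : ℝ → ℂ} (hg : IntegrableOn g I) {x s : ℝ}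
    (hL : IsLebesguePoint (I.indicator g) x) (hs : 0 < s) (hs1 : s ≤ 1) {L : ℂ}
    (h : Tendsto (fun η : ℝ => ∫ y in I, g y *
      (conjKernel (x * Real.cosh η - y) (s * Real.sinh η) : ℂ)) (𝓝[>] 0) (𝓝 L)) :
    HasPV (fun y => g y / ((x : ℂ) - y)) x L := by
  refine ⟨fun ε hε => integrableOn_truncated hg x hε, ?_⟩
  set G := I.indicator g with hGdef
  have hG : Integrable G := (integrable_indicator_iff measurableSet_I).2 hg
  have hYpos : ∀ η : ℝ, 0 < η → 0 < s * Real.sinh η := fun η hη =>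
    mul_pos hs (Real.sinh_pos_iff.2 hη)
  have hI : ∀ k : ℝ → ℂ, ∫ y in I, g y * k y = ∫ y, G y * k y := fun k => by
    rw [← integral_indicator measurableSet_I]
    refine integral_congr_ae (ae_of_all _ fun y => ?_)
    simp only [hGdef, indicator]
    split_ifs <;> simp
  simp only [hI] at h
  have hmT : ∀ η, AEStronglyMeasurable (fun y : ℝ => (truncKernel η (x - y) : ℂ)) := fun η =>
    (Complex.measurable_ofReal.comp
      ((measurable_truncKernel η).comp (by fun_prop))).aestronglyMeasurable
  have hmC : ∀ η : ℝ, 0 < η → ∀ b : ℝ, AEStronglyMeasurable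
      (fun y : ℝ => (conjKernel (b - y) (s * Real.sinh η) : ℂ)) := fun η hη b =>
    (Complex.continuous_ofReal.comp
      ((continuous_conjKernel (hYpos η hη)).comp (by fun_prop))).aestronglyMeasurable
  have hiT : ∀ η : ℝ, 0 < η → Integrable fun y => G y * (truncKernel η (x - y) : ℂ) :=
    fun η hη => hG.mul_bdd (c := 1 / η) (hmT η) (ae_of_all _ fun y => by
      rw [Complex.norm_real]; exact abs_truncKernel_le hη _)
  have hiC : ∀ η : ℝ, 0 < η → ∀ b : ℝ,
      Integrable fun y => G y * (conjKernel (b - y) (s * Real.sinh η) : ℂ) :=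
    fun η hη b => hG.mul_bdd (c := 1 / (s * Real.sinh η)) (hmC η hη b) (ae_of_all _ fun y => by
      rw [Complex.norm_real]; exact abs_conjKernel_le (hYpos η hη) _)
  -- The difference kernel is odd, so its integral over a ball centred at `x` vanishes and the
  -- Lebesgue point limit is 0.
  have hK : Tendsto (fun η => ∫ y, G y *
      ((conjKernel (x - y) (s * Real.sinh η) - truncKernel η (x - y) : ℝ) : ℂ))
      (𝓝[>] 0) (𝓝 (0 * G x)) := by
    refine hL.tendsto_integral_mul hG (s := Metric.closedBall x 1)
      (c := 4 / s ^ 2) (K := fun η y =>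
      ((conjKernel (x - y) (s * Real.sinh η) - truncKernel η (x - y) : ℝ) : ℂ))
      Metric.isClosed_closedBall.measurableSet (Metric.closedBall_mem_nhds x one_pos)
      measure_closedBall_lt_top.ne ?_ ?_ ?_
    · filter_upwards [self_mem_nhdsWithin] with η hη
      simp only [Complex.ofReal_sub]
      exact (hmC η hη x).sub (hmT η)
    · filter_upwards [Ioo_mem_nhdsGT one_pos] with η hη y
      rw [Complex.norm_real, show (y - x) ^ 2 = (x - y) ^ 2 by ring]
      exact abs_conjKernel_sub_truncKernel_le hs hs1 hη _
    · refine tendsto_const_nhds.congr fun η => ?_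
      refine (setIntegral_closedBall_eq_zero_of_odd
        (k := fun u => ((conjKernel u (s * Real.sinh η) - truncKernel η u : ℝ) : ℂ))
        (fun u => ?_) x 1).symm
      rw [conjKernel_neg, truncKernel_neg]
      push_cast
      ring
  -- The curve has abscissa `x cosh η` rather than `x`. Since `cosh η - 1 ≤ sinh² η`, the shift
  -- changes the kernel by at most `|x| / s²`, and pointwise by `o(1)` off `x`; dominated
  -- convergence applies.
  have hS : Tendsto (fun η => ∫ y, G y *
      ((conjKernel (x * Real.cosh η - y) (s * Real.sinh η) -
        conjKernel (x - y) (s * Real.sinh η) : ℝ) : ℂ)) (𝓝[>] 0) (𝓝 (∫ _ : ℝ, (0 : ℂ))) := by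
    refine tendsto_integral_filter_of_dominated_convergence
      (fun y => ‖G y‖ * (|x| / s ^ 2)) ?_ ?_ (hG.norm.mul_const _) ?_
    · filter_upwards [self_mem_nhdsWithin] with η hη
      simp only [Complex.ofReal_sub]
      exact hG.aestronglyMeasurable.mul ((hmC η hη _).sub (hmC η hη _))
    · filter_upwards [self_mem_nhdsWithin] with η hη
      have hη : 0 < η := hη
      refine ae_of_all _ fun y => ?_
      rw [norm_mul, Complex.norm_real]
      refine mul_le_mul_of_nonneg_left ?_ (norm_nonneg _)
      refine (abs_conjKernel_sub_le (hYpos η hη)).trans ?_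
      have hsh : 0 < Real.sinh η := Real.sinh_pos_iff.2 hη
      have hch := Real.one_le_cosh η
      have hsq := Real.cosh_sq η
      have e : x * Real.cosh η - y - (x - y) = x * (Real.cosh η - 1) := by ring
      rw [e, abs_mul, abs_of_nonneg (show 0 ≤ Real.cosh η - 1 by linarith),
        div_le_div_iff₀ (by positivity) (by positivity), mul_pow]
      have : Real.cosh η - 1 ≤ Real.sinh η ^ 2 := by nlinarith
      calc |x| * (Real.cosh η - 1) * s ^ 2 ≤ |x| * Real.sinh η ^ 2 * s ^ 2 := by gcongr
        _ = _ := by ring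
    · have hne : ∀ᵐ y : ℝ, y ≠ x := by simp [ae_iff]
      filter_upwards [hne] with y hy
      have hd : (x - y) ^ 2 ≠ 0 := pow_ne_zero 2 (sub_ne_zero.2 hy.symm)
      have hc : ContinuousAt (fun η : ℝ => G y *
          ((conjKernel (x * Real.cosh η - y) (s * Real.sinh η) -
            conjKernel (x - y) (s * Real.sinh η) : ℝ) : ℂ)) 0 := by
        refine continuousAt_const.mul (Complex.continuous_ofReal.continuousAt.comp ?_)
        unfold conjKernel
        refine ContinuousAt.sub (ContinuousAt.div ?_ ?_ ?_) (ContinuousAt.div ?_ ?_ ?_)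
        any_goals fun_prop
        all_goals simpa using hd
      have := hc.tendsto
      simp only [Real.cosh_zero, mul_one, Real.sinh_zero, sub_self, Complex.ofReal_zero,
        mul_zero] at this
      exact this.mono_left nhdsWithin_le_nhds
  have hfin := (h.sub hS).sub hK
  rw [integral_zero, sub_zero, zero_mul, sub_zero] at hfin
  refine hfin.congr' ?_
  filter_upwards [self_mem_nhdsWithin] with η hη
  rw [setIntegral_truncated_eq, ← hGdef]
  have e1 : ∫ y, G y * ((conjKernel (x * Real.cosh η - y) (s * Real.sinh η) -
        conjKernel (x - y) (s * Real.sinh η) : ℝ) : ℂ) =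
      (∫ y, G y * (conjKernel (x * Real.cosh η - y) (s * Real.sinh η) : ℂ)) -
        ∫ y, G y * (conjKernel (x - y) (s * Real.sinh η) : ℂ) := by
    rw [← integral_sub (hiC η hη _) (hiC η hη _)]
    simp only [Complex.ofReal_sub, mul_sub]
  have e2 : ∫ y, G y * ((conjKernel (x - y) (s * Real.sinh η) - truncKernel η (x - y) : ℝ) : ℂ) =
      (∫ y, G y * (conjKernel (x - y) (s * Real.sinh η) : ℂ)) -
        ∫ y, G y * (truncKernel η (x - y) : ℂ) := by
    rw [← integral_sub (hiC η hη _) (hiT η hη)]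
    simp only [Complex.ofReal_sub, mul_sub]
  rw [e1, e2]
  ring

/-! ### The finite Hilbert transform of even and odd lifts. -/

/-- The points `cos(±θ + iη)` are complex conjugates, and the conjugate kernel is the real part of
the Cauchy kernel. Both arguments have positive imaginary part, so each half is a Poisson integral.
-/
theorem conjKernel_eq_inv_cos_sub {θ η : ℝ} (hθ : θ ∈ Ioo 0 Real.pi) (hη : 0 < η) (y : ℝ) :
    (conjKernel (Real.cos θ * Real.cosh η - y) (Real.sin θ * Real.sinh η) : ℂ) =
      1 / 2 * (Complex.cos (θ + η * Complex.I) - y)⁻¹ +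
        1 / 2 * (Complex.cos ((-θ : ℝ) + η * Complex.I) - y)⁻¹ := by
  have hY : 0 < Real.sin θ * Real.sinh η :=
    mul_pos (Real.sin_pos_of_mem_Ioo hθ) (Real.sinh_pos_iff.2 hη)
  have e1 : Complex.cos (θ + η * Complex.I) - y =
      ((Real.cos θ * Real.cosh η - y : ℝ) : ℂ) -
        ((Real.sin θ * Real.sinh η : ℝ) : ℂ) * Complex.I := by
    rw [Complex.cos_add, Complex.cos_mul_I, Complex.sin_mul_I]
    push_cast
    ring
  have e2 : Complex.cos ((-θ : ℝ) + η * Complex.I) - y =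
      ((Real.cos θ * Real.cosh η - y : ℝ) : ℂ) +
        ((Real.sin θ * Real.sinh η : ℝ) : ℂ) * Complex.I := by
    rw [Complex.cos_add, Complex.cos_mul_I, Complex.sin_mul_I]
    push_cast
    rw [Complex.cos_neg, Complex.sin_neg]
    ring
  rw [e1, e2]
  set u := Real.cos θ * Real.cosh η - y
  set Y := Real.sin θ * Real.sinh η
  have h0 : ((u : ℂ) - Y * Complex.I) * (u + Y * Complex.I) = ((u ^ 2 + Y ^ 2 : ℝ) : ℂ) := by
    push_cast
    linear_combination -(Y : ℂ) ^ 2 * Complex.I_mul_I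
  have hne : ((u ^ 2 + Y ^ 2 : ℝ) : ℂ) ≠ 0 := by
    exact_mod_cast (by positivity : u ^ 2 + Y ^ 2 ≠ 0)
  have h1 : (u : ℂ) - Y * Complex.I ≠ 0 := fun h => hne (by rw [← h0, h, zero_mul])
  have h2 : (u : ℂ) + Y * Complex.I ≠ 0 := fun h => hne (by rw [← h0, h, mul_zero])
  rw [conjKernel, Complex.ofReal_div, ← h0]
  field_simp
  ring

/-- The finite Hilbert transform of a function with even lift `a φ + a (-φ)`. -/
theorem IsEvenLift.ae_hasPV {g a : ℝ → ℂ} (h : IsEvenLift g a) (ha : HardyOne a) :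
    ∀ᵐ θ ∂volume.restrict (Ioo 0 Real.pi), HasPV (fun y => g y / ((Real.cos θ : ℂ) - y))
      (Real.cos θ) (Real.pi * Complex.I / Real.sin θ * (a θ - a (-θ))) := by
  have hg := h.integrableOn ha.integrable
  have hL : ∀ᵐ x ∂volume.restrict I, IsLebesguePoint (I.indicator g) x :=
    ae_restrict_of_ae (ae_isLebesguePoint ((integrable_indicator_iff measurableSet_I).2 hg))
  filter_upwards [ae_I_iff.1 hL, ae_Ioo_of_ae_circ ha.ae_tendsto_integral_mul_poisson,
    ae_Ioo_of_ae_circ (ae_circ_neg ha.ae_tendsto_integral_mul_poisson),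
    ae_restrict_mem measurableSet_Ioo] with θ hθL hP hN hθ
  have hs := Real.sin_pos_of_mem_Ioo hθ
  refine hasPV_of_tendsto_conjKernel hg hθL hs (Real.sin_le_one θ) ?_
  have hlim : ∀ θ' : ℝ, Real.sin θ' ≠ 0 → Tendsto (fun η : ℝ => ∫ φ, a φ *
      poisson (Complex.exp ((θ' + η * Complex.I) * Complex.I)) φ ∂circ) (𝓝[>] 0)
      (𝓝 (2 * Real.pi * a θ')) →
      Tendsto (fun η : ℝ => Complex.I / Complex.sin (θ' + η * Complex.I) * ∫ φ, a φ *
      poisson (Complex.exp ((θ' + η * Complex.I) * Complex.I)) φ ∂circ) (𝓝[>] 0)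
      (𝓝 (Complex.I / Real.sin θ' * (2 * Real.pi * a θ'))) := by
    intro θ' hθ' hT
    refine Tendsto.mul ?_ hT
    have hc : ContinuousAt (fun η : ℝ => Complex.I / Complex.sin (θ' + η * Complex.I)) 0 := by
      refine continuousAt_const.div (by fun_prop) ?_
      rw [Complex.ofReal_zero, zero_mul, add_zero, ← Complex.ofReal_sin]
      exact_mod_cast hθ'
    have := hc.tendsto
    rw [Complex.ofReal_zero, zero_mul, add_zero, ← Complex.ofReal_sin] at this
    exact this.mono_left nhdsWithin_le_nhds
  -- The boundary limits at `θ` and `-θ` enter with opposite signs because `sin` is odd; hence the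
  -- minus sign in the result.
  have h1 := (hlim θ hs.ne' hP).const_mul (1 / 2)
  have h2 := (hlim (-θ) (by rw [Real.sin_neg]; exact neg_ne_zero.2 hs.ne') hN).const_mul (1 / 2)
  have h3 := h1.add h2
  have hval : 1 / 2 * (Complex.I / Real.sin θ * (2 * Real.pi * a θ)) +
      1 / 2 * (Complex.I / Real.sin (-θ) * (2 * Real.pi * a (-θ))) =
      Real.pi * Complex.I / Real.sin θ * (a θ - a (-θ)) := by
    rw [Real.sin_neg]
    have : (Real.sin θ : ℂ) ≠ 0 := by exact_mod_cast hs.ne'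
    push_cast at this ⊢
    field_simp
    ring
  rw [hval] at h3
  refine h3.congr' ?_
  filter_upwards [self_mem_nhdsWithin] with η hη
  have hη : 0 < η := hη
  obtain ⟨i1, e1⟩ := ha.integral_mul_inv_cos_sub_cos (τ := θ + η * Complex.I) (by simpa using hη)
  obtain ⟨i2, e2⟩ := ha.integral_mul_inv_cos_sub_cos (τ := (-θ : ℝ) + η * Complex.I)
    (by simpa using hη)
  have hsplit : ∀ φ : ℝ, a φ * (conjKernel (Real.cos θ * Real.cosh η - Real.cos φ)
      (Real.sin θ * Real.sinh η) : ℂ) =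
      1 / 2 * (a φ * (Complex.cos (θ + η * Complex.I) - Real.cos φ)⁻¹) +
      1 / 2 * (a φ * (Complex.cos ((-θ : ℝ) + η * Complex.I) - Real.cos φ)⁻¹) := by
    intro φ
    rw [conjKernel_eq_inv_cos_sub hθ hη]
    ring
  rw [h.integral_mul (K := fun y => (conjKernel (Real.cos θ * Real.cosh η - y)
    (Real.sin θ * Real.sinh η) : ℂ))]
  · simp only [hsplit]
    rw [integral_add (i1.const_mul _) (i2.const_mul _), integral_const_mul, integral_const_mul,
      e1, e2]
  · simp only [hsplit]
    exact (i1.const_mul _).add (i2.const_mul _)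

/-- `g` corresponds on `(-1, 1)` to the odd function `φ ↦ a φ - a (-φ)` under `y = cos φ`. -/
def IsOddLift (g a : ℝ → ℂ) : Prop :=
  ∀ᵐ φ ∂volume.restrict (Ioo 0 Real.pi), g (Real.cos φ) = a φ - a (-φ)

/-- The finite Hilbert transform of a function with odd lift `a φ - a (-φ)`. -/
theorem IsOddLift.ae_hasPV {g a : ℝ → ℂ} (h : IsOddLift g a) (ha : HardyOne a)
    (h0 : ∫ φ, a φ ∂circ = 0) :
    ∀ᵐ θ ∂volume.restrict (Ioo 0 Real.pi), HasPV (fun y => g y / ((Real.cos θ : ℂ) - y))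
      (Real.cos θ) (Real.pi * Complex.I * (a θ + a (-θ))) := by
  -- Multiplying by `sin` turns the odd lift into an even one, of Hardy type because `a` has mean
  -- zero.
  have he : IsEvenLift g fun φ => Real.sin φ * a φ := by
    filter_upwards [h] with φ hφ
    rw [hφ, Real.sin_neg]
    push_cast
    ring
  filter_upwards [he.ae_hasPV (ha.sin_mul h0), ae_restrict_mem measurableSet_Ioo] with θ hp hθ
  have hs : (Real.sin θ : ℂ) ≠ 0 := by exact_mod_cast (Real.sin_pos_of_mem_Ioo hθ).ne'
  convert hp using 1
  rw [Real.sin_neg]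
  push_cast at hs ⊢
  field_simp
  ring

/-! ### Reduction of both kernels to the plain one, and lifts of the weighted L² spaces. -/

theorem HasPV.add {g₁ g₂ : ℝ → ℂ} {x : ℝ} {L₁ L₂ : ℂ} (h₁ : HasPV g₁ x L₁) (h₂ : HasPV g₂ x L₂) :
    HasPV (fun y => g₁ y + g₂ y) x (L₁ + L₂) := by
  refine ⟨fun ε hε => (h₁.1 ε hε).add (h₂.1 ε hε), (h₁.2.add h₂.2).congr' ?_⟩
  filter_upwards [self_mem_nhdsWithin] with ε hε
  exact (integral_add (h₁.1 ε hε) (h₂.1 ε hε)).symm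

theorem HasPV.const_mul {g : ℝ → ℂ} {x : ℝ} {L : ℂ} (h : HasPV g x L) (c : ℂ) :
    HasPV (fun y => c * g y) x (c * L) := by
  refine ⟨fun ε hε => (h.1 ε hε).const_mul c, (h.2.const_mul c).congr fun ε => ?_⟩
  exact (integral_const_mul c _).symm

theorem hasPV_coshKernel {μ : ℂ} {f : ℝ → ℂ} {x : ℝ} {L₁ L₂ : ℂ}
    (h₁ : HasPV (fun y => Complex.exp (-(μ * y)) * f y / ((x : ℂ) - y)) x L₁)
    (h₂ : HasPV (fun y => Complex.exp (μ * y) * f y / ((x : ℂ) - y)) x L₂) :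
    HasPV (coshKernel μ f x) x
      (Complex.exp (μ * x) / 2 * L₁ + Complex.exp (-(μ * x)) / 2 * L₂) := by
  convert (h₁.const_mul (Complex.exp (μ * x) / 2)).add
    (h₂.const_mul (Complex.exp (-(μ * x)) / 2)) using 1
  funext y
  rw [coshKernel, Complex.cosh, show μ * ((x : ℂ) - y) = μ * x + -(μ * y) by ring,
    show -(μ * (x : ℂ) + -(μ * y)) = -(μ * x) + μ * y by ring, Complex.exp_add, Complex.exp_add]
  ring

theorem hasPV_invKernel {F k : ℝ → ℂ} {x : ℝ} {L : ℂ}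
    (h : HasPV (fun y => F y * k y / ((x : ℂ) - y)) x L) : HasPV (invKernel F k x) x (-L) := by
  convert h.const_mul (-1) using 1
  · funext y
    rw [invKernel, ← neg_sub (x : ℂ) y, div_neg]
    ring
  · ring

/-- Extend by zero to `(-π, π)` and add the reflection, which makes the function even without
changing it on `(0, π)`. -/
theorem exists_even_lift {k : ℝ → ℂ} (hk : MemLp k 2 (volume.restrict (Ioo 0 Real.pi))) :
    ∃ a : ℝ → ℂ, HardyOne a ∧
      ∀ᵐ φ ∂volume.restrict (Ioo 0 Real.pi), k φ = a φ + a (-φ) := by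
  have hk1 : MemLp ((Ioo 0 Real.pi).indicator k) 2 circ :=
    ((memLp_indicator_iff_restrict measurableSet_Ioo).2 hk).restrict _
  obtain ⟨a, ha, h⟩ := exists_hardyOne_of_even
    (hk1.add (hk1.comp_measurePreserving measurePreserving_neg_circ))
    (fun φ => by simp [add_comm])
  refine ⟨a, ha, ?_⟩
  filter_upwards [ae_Ioo_of_ae_circ h, ae_restrict_mem measurableSet_Ioo] with φ hφ hm
  have : -φ ∉ Ioo 0 Real.pi := fun h => by linarith [h.1, hm.1]
  simpa [indicator_of_mem hm, indicator_of_notMem this] using hφ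

theorem exists_odd_lift {k : ℝ → ℂ} (hk : MemLp k 2 (volume.restrict (Ioo 0 Real.pi))) :
    ∃ a : ℝ → ℂ, HardyOne a ∧ ∫ φ, a φ ∂circ = 0 ∧
      ∀ᵐ φ ∂volume.restrict (Ioo 0 Real.pi), k φ = a φ - a (-φ) := by
  have hk1 : MemLp ((Ioo 0 Real.pi).indicator k) 2 circ :=
    ((memLp_indicator_iff_restrict measurableSet_Ioo).2 hk).restrict _
  obtain ⟨a, ha, h0, h⟩ := exists_hardyOne_of_odd
    (hk1.sub (hk1.comp_measurePreserving measurePreserving_neg_circ))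
    (fun φ => by simp)
  refine ⟨a, ha, h0, ?_⟩
  filter_upwards [ae_Ioo_of_ae_circ h, ae_restrict_mem measurableSet_Ioo] with φ hφ hm
  have : -φ ∉ Ioo 0 Real.pi := fun h => by linarith [h.1, hm.1]
  simpa [indicator_of_mem hm, indicator_of_notMem this] using hφ

theorem quasiMeasurePreserving_cos : Measure.QuasiMeasurePreserving Real.cos
    (volume.restrict (Ioo 0 Real.pi)) (volume.restrict I) := by
  refine ⟨Real.measurable_cos, Measure.AbsolutelyContinuous.mk fun s hs h => ?_⟩
  rw [Measure.map_apply Real.measurable_cos hs]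
  have h1 : ∀ᵐ x ∂volume.restrict I, x ∉ s := measure_eq_zero_iff_ae_notMem.1 h
  exact measure_eq_zero_iff_ae_notMem.2 (ae_I_iff.1 h1)

theorem memLp_mul_exp_cos {k : ℝ → ℂ} (hk : MemLp k 2 (volume.restrict (Ioo 0 Real.pi))) (μ : ℂ) :
    MemLp (fun φ : ℝ => Complex.exp (μ * Real.cos φ) * k φ) 2
      (volume.restrict (Ioo 0 Real.pi)) := by
  refine hk.of_le_mul (c := Real.exp ‖μ‖) ?_ (ae_of_all _ fun φ => ?_)
  · exact AEStronglyMeasurable.mul (by fun_prop) hk.aestronglyMeasurable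
  · rw [norm_mul]
    refine mul_le_mul_of_nonneg_right ((Complex.norm_exp_le_exp_norm _).trans ?_) (norm_nonneg _)
    rw [norm_mul, Complex.norm_real]
    exact Real.exp_le_exp.2 (mul_le_of_le_one_right (norm_nonneg _) (Real.abs_cos_le_one φ))

theorem MemL2d.memLp_comp_cos {f : ℝ → ℂ} (hf : MemL2d f) :
    MemLp (fun φ => f (Real.cos φ)) 2 (volume.restrict (Ioo 0 Real.pi)) := by
  have hm : AEStronglyMeasurable (fun φ => f (Real.cos φ)) (volume.restrict (Ioo 0 Real.pi)) :=
    hf.1.comp_quasiMeasurePreserving quasiMeasurePreserving_cos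
  rw [memLp_two_iff_integrable_sq_norm hm]
  have h := (integrableOn_I_iff _).1 hf.2
  refine h.congr_fun (fun φ hφ => ?_) measurableSet_Ioo
  have hs := Real.sin_pos_of_mem_Ioo hφ
  simp only [w_cos hφ, smul_eq_mul]
  field_simp

theorem MemL2m.memLp_sin_mul_comp_cos {f : ℝ → ℂ} (hf : MemL2m f) :
    MemLp (fun φ => Real.sin φ * f (Real.cos φ)) 2 (volume.restrict (Ioo 0 Real.pi)) := by
  have hm : AEStronglyMeasurable (fun φ : ℝ => Real.sin φ * f (Real.cos φ))
      (volume.restrict (Ioo 0 Real.pi)) :=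
    AEStronglyMeasurable.mul (by fun_prop)
      (hf.1.comp_quasiMeasurePreserving quasiMeasurePreserving_cos)
  rw [memLp_two_iff_integrable_sq_norm hm]
  have h := (integrableOn_I_iff _).1 hf.2
  refine h.congr_fun (fun φ hφ => ?_) measurableSet_Ioo
  simp only [w_cos hφ, smul_eq_mul, norm_mul, Complex.norm_real, mul_pow, Real.norm_eq_abs, sq_abs]
  ring

/-! ### The outer factor and the two inversion formulas. -/

/-- The function `exp (μ exp (i φ) / 2)`, which belongs to the Hardy class together with its
inverse. -/
def outer (μ : ℂ) (φ : ℝ) : ℂ := Complex.exp (μ / 2 * Complex.exp (φ * Complex.I))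

theorem outer_ne_zero (μ : ℂ) (φ : ℝ) : outer μ φ ≠ 0 := Complex.exp_ne_zero _

theorem outer_mul_outer_neg (μ : ℂ) (φ : ℝ) :
    outer μ φ * outer μ (-φ) = Complex.exp (μ * Real.cos φ) := by
  rw [outer, outer, ← Complex.exp_add, Complex.ofReal_cos, Complex.cos]
  push_cast
  congr 1
  ring

theorem outer_div_outer_neg (μ : ℂ) (φ : ℝ) :
    outer μ φ / outer μ (-φ) = Complex.exp (Complex.I * μ * Real.sin φ) := by
  rw [outer, outer, ← Complex.exp_sub, Complex.ofReal_sin, Complex.sin]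
  push_cast
  congr 1
  linear_combination (μ / 2 * (Complex.exp (φ * Complex.I) - Complex.exp (-φ * Complex.I))) *
    Complex.I_mul_I

theorem outer_sq (μ : ℂ) (φ : ℝ) :
    Complex.exp (μ * Complex.exp (φ * Complex.I)) = outer μ φ ^ 2 := by
  rw [outer, ← Complex.exp_nat_mul]
  congr 1
  push_cast
  ring

theorem inv_outer_sq (μ : ℂ) (φ : ℝ) :
    Complex.exp (-μ * Complex.exp (φ * Complex.I)) = (outer μ φ ^ 2)⁻¹ := by
  rw [← outer_sq, ← Complex.exp_neg, neg_mul]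

theorem C_cos (μ : ℂ) {φ : ℝ} (hφ : φ ∈ Ioo 0 Real.pi) :
    C μ (Real.cos φ) =
      (outer μ φ / outer μ (-φ) + outer μ (-φ) / outer μ φ) / 2 := by
  have h := outer_div_outer_neg μ (-φ)
  rw [neg_neg, Real.sin_neg] at h
  rw [C, w_cos hφ, Complex.cosh, outer_div_outer_neg, h]
  push_cast
  ring_nf

theorem S_cos (μ : ℂ) {φ : ℝ} (hφ : φ ∈ Ioo 0 Real.pi) :
    S μ (Real.cos φ) =
      (outer μ φ / outer μ (-φ) - outer μ (-φ) / outer μ φ) / 2 := by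
  have h := outer_div_outer_neg μ (-φ)
  rw [neg_neg, Real.sin_neg] at h
  rw [S, w_cos hφ, Complex.sinh, outer_div_outer_neg, h]
  push_cast
  ring_nf

/-- The weighted combination `(i / 2) (E² a₁ + ε E⁻² a₂)`, where `E = outer μ`. -/
def outerComb (μ ε : ℂ) (a₁ a₂ : ℝ → ℂ) (φ : ℝ) : ℂ :=
  Complex.I / 2 * (a₁ φ * Complex.exp (μ * Complex.exp (φ * Complex.I)) +
    ε * (a₂ φ * Complex.exp (-μ * Complex.exp (φ * Complex.I))))

theorem outerComb_apply (μ ε : ℂ) (a₁ a₂ : ℝ → ℂ) (φ : ℝ) :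
    outerComb μ ε a₁ a₂ φ =
      Complex.I / 2 * (a₁ φ * outer μ φ ^ 2 + ε * (a₂ φ * (outer μ φ ^ 2)⁻¹)) := by
  rw [outerComb, inv_outer_sq, outer_sq]

theorem HardyOne.outerComb {a₁ a₂ : ℝ → ℂ} (h₁ : HardyOne a₁) (h₂ : HardyOne a₂) (μ ε : ℂ) :
    HardyOne (outerComb μ ε a₁ a₂) :=
  ((h₁.mul_exp_mul_exp μ).add ((h₂.mul_exp_mul_exp (-μ)).const_mul ε)).const_mul _

theorem HardyOne.integral_outerComb {a₁ a₂ : ℝ → ℂ} (h₁ : HardyOne a₁) (h₂ : HardyOne a₂)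
    (μ ε : ℂ) : ∫ φ, CoshFHT.outerComb μ ε a₁ a₂ φ ∂circ =
      Complex.I / 2 * (∫ φ, a₁ φ ∂circ + ε * ∫ φ, a₂ φ ∂circ) := by
  simp only [CoshFHT.outerComb]
  rw [integral_const_mul, integral_add (h₁.mul_exp_mul_exp μ).integrable
    ((h₂.mul_exp_mul_exp (-μ)).const_mul ε).integrable, integral_const_mul,
    h₁.integral_mul_exp_mul_exp, h₂.integral_mul_exp_mul_exp]

theorem MemL2d.inversion {f : ℝ → ℂ} (hf : MemL2d f) (μ : ℂ) :
    (∀ᵐ s ∂volume.restrict I, PVExists (coshKernel μ f s) s) ∧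
    ∀ᵐ t ∂volume.restrict I,
      PVExists (invKernel (coshFHT μ f) (fun s => C μ s / (w s : ℂ)) t) t ∧
      PVExists (invKernel (coshFHT μ f) (S μ) t) t ∧
      f t = C μ t * (w t : ℂ) * ((1 / (Real.pi : ℂ)) *
          pv (invKernel (coshFHT μ f) (fun s => C μ s / (w s : ℂ)) t) t) -
        S μ t * ((1 / (Real.pi : ℂ)) * pv (invKernel (coshFHT μ f) (S μ) t) t) := by
  have hk := hf.memLp_comp_cos
  obtain ⟨a₁, h₁, m₁, e₁⟩ := exists_odd_lift (memLp_mul_exp_cos hk (-μ))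
  obtain ⟨a₂, h₂, m₂, e₂⟩ := exists_odd_lift (memLp_mul_exp_cos hk μ)
  have l₁ : IsOddLift (fun y => Complex.exp (-(μ * y)) * f y) a₁ := by
    filter_upwards [e₁] with φ hφ
    rw [← hφ, neg_mul]
  have l₂ : IsOddLift (fun y => Complex.exp (μ * y) * f y) a₂ := e₂
  have hπ : (Real.pi : ℂ) ≠ 0 := by exact_mod_cast Real.pi_ne_zero
  have hF : ∀ᵐ φ ∂volume.restrict (Ioo 0 Real.pi),
      PVExists (coshKernel μ f (Real.cos φ)) (Real.cos φ) ∧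
      coshFHT μ f (Real.cos φ) = Complex.I / 2 *
        (outer μ φ * outer μ (-φ) * (a₁ φ + a₁ (-φ)) +
          (outer μ φ * outer μ (-φ))⁻¹ * (a₂ φ + a₂ (-φ))) := by
    filter_upwards [l₁.ae_hasPV h₁ m₁, l₂.ae_hasPV h₂ m₂] with φ p₁ p₂
    have p := hasPV_coshKernel p₁ p₂
    refine ⟨⟨_, p⟩, ?_⟩
    rw [coshFHT, p.pv_eq, outer_mul_outer_neg, Complex.exp_neg]
    field_simp
  have hα : IsEvenLift (fun y => coshFHT μ f y * (C μ y / (w y : ℂ)))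
      (outerComb μ 1 a₁ a₂) := by
    filter_upwards [hF, e₁, e₂, ae_restrict_mem measurableSet_Ioo] with φ hφ q₁ q₂ hm
    have hs : (Real.sin φ : ℂ) ≠ 0 := by exact_mod_cast (Real.sin_pos_of_mem_Ioo hm).ne'
    rw [neg_mul, Complex.exp_neg, ← outer_mul_outer_neg] at q₁
    rw [← outer_mul_outer_neg] at q₂
    rw [hφ.2, C_cos μ hm, w_cos hm, outerComb_apply, outerComb_apply]
    have hP := outer_ne_zero μ φ
    have hQ := outer_ne_zero μ (-φ)
    set P := outer μ φ
    set Q := outer μ (-φ)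
    -- Both lifts carry the same `f`, with factors `(PQ)⁻¹` and `PQ`; this is what cancels the cross
    -- terms `P² a₁ (-φ)`, `Q² a₁ φ` and their analogues for `a₂`.
    have r₁ : a₁ φ = a₁ (-φ) + (P * Q)⁻¹ * f (Real.cos φ) := by linear_combination -q₁
    have r₂ : a₂ φ = a₂ (-φ) + P * Q * f (Real.cos φ) := by linear_combination -q₂
    rw [r₁, r₂]
    field_simp
    ring
  have hβ : IsOddLift (fun y => coshFHT μ f y * S μ y) (outerComb μ (-1) a₁ a₂) := by
    filter_upwards [hF, e₁, e₂, ae_restrict_mem measurableSet_Ioo] with φ hφ q₁ q₂ hm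
    rw [neg_mul, Complex.exp_neg, ← outer_mul_outer_neg] at q₁
    rw [← outer_mul_outer_neg] at q₂
    rw [hφ.2, S_cos μ hm, outerComb_apply, outerComb_apply]
    have hP := outer_ne_zero μ φ
    have hQ := outer_ne_zero μ (-φ)
    set P := outer μ φ
    set Q := outer μ (-φ)
    have r₁ : a₁ φ = a₁ (-φ) + (P * Q)⁻¹ * f (Real.cos φ) := by linear_combination -q₁
    have r₂ : a₂ φ = a₂ (-φ) + P * Q * f (Real.cos φ) := by linear_combination -q₂
    rw [r₁, r₂]
    field_simp
    ring
  refine ⟨ae_I_iff.2 (hF.mono fun φ hφ => hφ.1), ae_I_iff.2 ?_⟩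
  filter_upwards [hα.ae_hasPV (h₁.outerComb h₂ μ 1), hβ.ae_hasPV (h₁.outerComb h₂ μ (-1))
    -- The exponential factors preserve means, so the combination inherits mean zero from `a₁` and
    -- `a₂`.
    (by rw [h₁.integral_outerComb h₂, m₁, m₂]; simp), e₁, e₂,
    ae_restrict_mem measurableSet_Ioo] with φ pα pβ q₁ q₂ hm
  have pα' := hasPV_invKernel (k := fun s => C μ s / (w s : ℂ)) pα
  have pβ' := hasPV_invKernel pβ
  refine ⟨⟨_, pα'⟩, ⟨_, pβ'⟩, ?_⟩
  have hs : (Real.sin φ : ℂ) ≠ 0 := by exact_mod_cast (Real.sin_pos_of_mem_Ioo hm).ne'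
  rw [neg_mul, Complex.exp_neg, ← outer_mul_outer_neg] at q₁
  rw [← outer_mul_outer_neg] at q₂
  rw [pα'.pv_eq, pβ'.pv_eq, C_cos μ hm, S_cos μ hm, w_cos hm]
  simp only [outerComb_apply]
  have hP := outer_ne_zero μ φ
  have hQ := outer_ne_zero μ (-φ)
  set P := outer μ φ
  set Q := outer μ (-φ)
  have r₁ : a₁ φ = a₁ (-φ) + (P * Q)⁻¹ * f (Real.cos φ) := by linear_combination -q₁
  have r₂ : a₂ φ = a₂ (-φ) + P * Q * f (Real.cos φ) := by linear_combination -q₂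
  rw [r₁, r₂]
  field_simp
  ring_nf
  simp only [Complex.I_sq]
  ring

/-- The same scheme with the parities exchanged: here `sin φ · f(cos φ)` is in L², so `f` has even
lifts, and it is the `C` term that needs an odd lift of mean zero. -/
theorem MemL2m.inversion {f : ℝ → ℂ} (hf : MemL2m f) (μ : ℂ) :
    (∀ᵐ s ∂volume.restrict I, PVExists (coshKernel μ f s) s) ∧
    IntegrableOn (fun u : ℝ => Complex.cosh (μ * (u : ℂ)) * f u) I ∧
    ∀ᵐ t ∂volume.restrict I,
      PVExists (invKernel (coshFHT μ f) (fun s => C μ s * (w s : ℂ)) t) t ∧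
      PVExists (invKernel (coshFHT μ f) (S μ) t) t ∧
      f t = C μ t / (w t : ℂ) * ((1 / (Real.pi : ℂ)) *
          pv (invKernel (coshFHT μ f) (fun s => C μ s * (w s : ℂ)) t) t +
          (1 / (Real.pi : ℂ)) * ∫ u in I, Complex.cosh (μ * (u : ℂ)) * f u) -
        S μ t * ((1 / (Real.pi : ℂ)) * pv (invKernel (coshFHT μ f) (S μ) t) t) := by
  have hk := hf.memLp_sin_mul_comp_cos
  obtain ⟨a₁, h₁, e₁⟩ := exists_even_lift (memLp_mul_exp_cos hk (-μ))
  obtain ⟨a₂, h₂, e₂⟩ := exists_even_lift (memLp_mul_exp_cos hk μ)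
  have l₁ : IsEvenLift (fun y => Complex.exp (-(μ * y)) * f y) a₁ := by
    filter_upwards [e₁] with φ hφ
    rw [← hφ, neg_mul]
    ring
  have l₂ : IsEvenLift (fun y => Complex.exp (μ * y) * f y) a₂ := by
    filter_upwards [e₂] with φ hφ
    rw [← hφ]
    ring
  have hπ : (Real.pi : ℂ) ≠ 0 := by exact_mod_cast Real.pi_ne_zero
  have hcosh : ∀ u : ℝ, Complex.cosh (μ * (u : ℂ)) * f u =
      1 / 2 * (Complex.exp (-(μ * u)) * f u) + 1 / 2 * (Complex.exp (μ * u) * f u) := fun u => by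
    rw [Complex.cosh]; ring
  have g₁ := l₁.integrableOn h₁.integrable
  have g₂ := l₂.integrableOn h₂.integrable
  have hint : IntegrableOn (fun u : ℝ => Complex.cosh (μ * (u : ℂ)) * f u) I := by
    simp only [hcosh]
    exact (g₁.const_mul _).add (g₂.const_mul _)
  have hval : ∫ u in I, Complex.cosh (μ * (u : ℂ)) * f u =
      1 / 2 * (∫ φ, a₁ φ ∂circ + ∫ φ, a₂ φ ∂circ) := by
    simp only [hcosh]
    rw [integral_add (g₁.const_mul _) (g₂.const_mul _), integral_const_mul, integral_const_mul]
    have i₁ := l₁.integral_mul (K := fun _ => 1) (by simpa using h₁.integrable)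
    have i₂ := l₂.integral_mul (K := fun _ => 1) (by simpa using h₂.integrable)
    simp only [mul_one] at i₁ i₂
    rw [i₁, i₂]
    ring
  have hF : ∀ᵐ φ ∂volume.restrict (Ioo 0 Real.pi),
      PVExists (coshKernel μ f (Real.cos φ)) (Real.cos φ) ∧
      coshFHT μ f (Real.cos φ) = Complex.I / 2 / Real.sin φ *
        (outer μ φ * outer μ (-φ) * (a₁ φ - a₁ (-φ)) +
          (outer μ φ * outer μ (-φ))⁻¹ * (a₂ φ - a₂ (-φ))) := by
    filter_upwards [l₁.ae_hasPV h₁, l₂.ae_hasPV h₂, ae_restrict_mem measurableSet_Ioo]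
      with φ p₁ p₂ hm
    have hs : (Real.sin φ : ℂ) ≠ 0 := by exact_mod_cast (Real.sin_pos_of_mem_Ioo hm).ne'
    have p := hasPV_coshKernel p₁ p₂
    refine ⟨⟨_, p⟩, ?_⟩
    rw [coshFHT, p.pv_eq, outer_mul_outer_neg, Complex.exp_neg]
    field_simp
  -- The mean of `outerComb μ 1 a₁ a₂`. By `hval` it equals `i / (2π)` times the integral of
  -- `cosh(μu) f(u)`; subtracting it for the odd lift creates the additional term of the formula.
  set m : ℂ := Complex.I / 2 * (∫ φ, a₁ φ ∂circ + ∫ φ, a₂ φ ∂circ) / (2 * Real.pi) with hm_def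
  have hα : IsOddLift (fun y => coshFHT μ f y * (C μ y * (w y : ℂ)))
      (fun φ => outerComb μ 1 a₁ a₂ φ - m) := by
    filter_upwards [hF, e₁, e₂, ae_restrict_mem measurableSet_Ioo] with φ hφ q₁ q₂ hm
    have hs : (Real.sin φ : ℂ) ≠ 0 := by exact_mod_cast (Real.sin_pos_of_mem_Ioo hm).ne'
    rw [neg_mul, Complex.exp_neg, ← outer_mul_outer_neg] at q₁
    rw [← outer_mul_outer_neg] at q₂
    rw [hφ.2, C_cos μ hm, w_cos hm, outerComb_apply, outerComb_apply]
    have hP := outer_ne_zero μ φ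
    have hQ := outer_ne_zero μ (-φ)
    set P := outer μ φ
    set Q := outer μ (-φ)
    have r₁ : a₁ φ = -a₁ (-φ) + (P * Q)⁻¹ * (Real.sin φ * f (Real.cos φ)) := by
      linear_combination -q₁
    have r₂ : a₂ φ = -a₂ (-φ) + P * Q * (Real.sin φ * f (Real.cos φ)) := by
      linear_combination -q₂
    rw [r₁, r₂]
    field_simp
    ring
  have hβ : IsEvenLift (fun y => coshFHT μ f y * S μ y) (outerComb μ (-1) a₁ a₂) := by
    filter_upwards [hF, e₁, e₂, ae_restrict_mem measurableSet_Ioo] with φ hφ q₁ q₂ hm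
    have hs : (Real.sin φ : ℂ) ≠ 0 := by exact_mod_cast (Real.sin_pos_of_mem_Ioo hm).ne'
    rw [neg_mul, Complex.exp_neg, ← outer_mul_outer_neg] at q₁
    rw [← outer_mul_outer_neg] at q₂
    rw [hφ.2, S_cos μ hm, outerComb_apply, outerComb_apply]
    have hP := outer_ne_zero μ φ
    have hQ := outer_ne_zero μ (-φ)
    set P := outer μ φ
    set Q := outer μ (-φ)
    have r₁ : a₁ φ = -a₁ (-φ) + (P * Q)⁻¹ * (Real.sin φ * f (Real.cos φ)) := by
      linear_combination -q₁
    have r₂ : a₂ φ = -a₂ (-φ) + P * Q * (Real.sin φ * f (Real.cos φ)) := by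
      linear_combination -q₂
    rw [r₁, r₂]
    field_simp
    ring
  have hmean : ∫ φ, (outerComb μ 1 a₁ a₂ φ - m) ∂circ = 0 := by
    rw [integral_sub (h₁.outerComb h₂ μ 1).integrable (integrable_const m), integral_const,
      h₁.integral_outerComb h₂, circ_real_univ, Complex.real_smul, hm_def]
    push_cast
    field_simp
    ring
  refine ⟨ae_I_iff.2 (hF.mono fun φ hφ => hφ.1), hint, ae_I_iff.2 ?_⟩
  filter_upwards [hα.ae_hasPV ((h₁.outerComb h₂ μ 1).sub (hardyOne_const m)) hmean,
    hβ.ae_hasPV (h₁.outerComb h₂ μ (-1)), e₁, e₂,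
    ae_restrict_mem measurableSet_Ioo] with φ pα pβ q₁ q₂ hm
  have pα' := hasPV_invKernel (k := fun s => C μ s * (w s : ℂ)) pα
  have pβ' := hasPV_invKernel pβ
  refine ⟨⟨_, pα'⟩, ⟨_, pβ'⟩, ?_⟩
  have hs : (Real.sin φ : ℂ) ≠ 0 := by exact_mod_cast (Real.sin_pos_of_mem_Ioo hm).ne'
  rw [neg_mul, Complex.exp_neg, ← outer_mul_outer_neg] at q₁
  rw [← outer_mul_outer_neg] at q₂
  rw [pα'.pv_eq, pβ'.pv_eq, hval, C_cos μ hm, S_cos μ hm, w_cos hm, hm_def]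
  simp only [outerComb_apply]
  have hP := outer_ne_zero μ φ
  have hQ := outer_ne_zero μ (-φ)
  set P := outer μ φ
  set Q := outer μ (-φ)
  have r₁ : a₁ φ = -a₁ (-φ) + (P * Q)⁻¹ * (Real.sin φ * f (Real.cos φ)) := by
    linear_combination -q₁
  have r₂ : a₂ φ = -a₂ (-φ) + P * Q * (Real.sin φ * f (Real.cos φ)) := by
    linear_combination -q₂
  rw [r₁, r₂]
  field_simp
  ring_nf
  simp only [Complex.I_sq]
  ring

end CoshFHT

end

theorem theorem1 (μ : ℂ) :
    (∀ f : ℝ → ℂ, CoshFHT.MemL2d f →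
      (∀ᵐ s ∂volume.restrict CoshFHT.I, CoshFHT.PVExists (CoshFHT.coshKernel μ f s) s) ∧
      (∀ᵐ t ∂volume.restrict CoshFHT.I,
        CoshFHT.PVExists
          (CoshFHT.invKernel (CoshFHT.coshFHT μ f) (fun s => CoshFHT.C μ s / (CoshFHT.w s : ℂ)) t)
          t ∧
        CoshFHT.PVExists
          (CoshFHT.invKernel (CoshFHT.coshFHT μ f) (CoshFHT.S μ) t) t ∧
        f t =
          CoshFHT.C μ t * (CoshFHT.w t : ℂ) *
              ((1 / (Real.pi : ℂ)) * CoshFHT.pv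
                (CoshFHT.invKernel (CoshFHT.coshFHT μ f)
                  (fun s => CoshFHT.C μ s / (CoshFHT.w s : ℂ)) t) t)
            - CoshFHT.S μ t *
              ((1 / (Real.pi : ℂ)) * CoshFHT.pv
                (CoshFHT.invKernel (CoshFHT.coshFHT μ f) (CoshFHT.S μ) t) t))) ∧
    (∀ f : ℝ → ℂ, CoshFHT.MemL2m f →
      (∀ᵐ s ∂volume.restrict CoshFHT.I, CoshFHT.PVExists (CoshFHT.coshKernel μ f s) s) ∧
      IntegrableOn (fun u : ℝ => Complex.cosh (μ * (u : ℂ)) * f u) CoshFHT.I ∧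
      (∀ᵐ t ∂volume.restrict CoshFHT.I,
        CoshFHT.PVExists
          (CoshFHT.invKernel (CoshFHT.coshFHT μ f) (fun s => CoshFHT.C μ s * (CoshFHT.w s : ℂ)) t)
          t ∧
        CoshFHT.PVExists
          (CoshFHT.invKernel (CoshFHT.coshFHT μ f) (CoshFHT.S μ) t) t ∧
        f t =
          CoshFHT.C μ t / (CoshFHT.w t : ℂ) *
              ((1 / (Real.pi : ℂ)) * CoshFHT.pv
                  (CoshFHT.invKernel (CoshFHT.coshFHT μ f)
                    (fun s => CoshFHT.C μ s * (CoshFHT.w s : ℂ)) t) t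
                + (1 / (Real.pi : ℂ)) *
                  ∫ u in CoshFHT.I, Complex.cosh (μ * (u : ℂ)) * f u)
            - CoshFHT.S μ t *
              ((1 / (Real.pi : ℂ)) * CoshFHT.pv
                (CoshFHT.invKernel (CoshFHT.coshFHT μ f) (CoshFHT.S μ) t) t))) :=
  ⟨fun _ hf => CoshFHT.MemL2d.inversion hf μ, fun _ hf => CoshFHT.MemL2m.inversion hf μ⟩
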